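/- Let $g>0$, $\mu>0$, and let $\bar\rho\in C^\infty(\mathbb R)\cap L^\infty(\mathbb R)$ satisfy $\bar\rho'\in C_0^\infty(\mathbb R)$, $\inf_{\mathbb R}\bar\rho>0$ and $\bar\rho'(x^0)>0$ for some $x^0\in\mathbb R$. All functions are real-valued. Put $$M_{\mathrm c}:=\Big(\sup_{0\not\equiv\psi\in H^1(\mathbb R)}\frac{\int_{\mathbb R} g\bar\rho'|\psi|^2\,dx}{\int_{\mathbb R}|\psi'|^2\,dx}\Big)^{1/2}\in(0,\infty].$$ Let the constant magnetic field be either $\bar{\mathbf M}=M\mathbf e_1$ with $M\neq0$ (horizontal case) or $\bar{\mathbf M}=M\mathbf e_3$ with $0<|M|<M_{\mathrm c}$ (vertical case). For $\xi=(\xi_1,\xi_2)\in\mathbb R^2$ with $0<|M\xi_1|/|\xi|<M_{\mathrm c}$ put $$S(\xi):=\Big(\sup_{0\not\equiv\psi\in H^1(\mathbb R)}\frac{\frac{g|\xi|^2}{(M\xi_1)^2}\int_{\mathbb R}\bar\rho'\psi^2\,dx-\int_{\mathbb R}|\psi'|^2\,dx}{\int_{\mathbb R}|\psi|^2\,dx}\Big)^{1/2},$$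 and, in the vertical case, $$|\xi|_{\mathrm{vc}}^M:=\Big(\inf\Big\{\frac{M^2\int_{\mathbb R}|\psi''|^2\,dx}{\int_{\mathbb R}(g\bar\rho'\psi^2-M^2|\psi'|^2)\,dx}\;:\;\psi\in H^2(\mathbb R),\ \int_{\mathbb R}(g\bar\rho'\psi^2-M^2|\psi'|^2)\,dx>0\Big\}\Big)^{1/2}.$$ The solvable domain is $$\mathbb A^{\mathrm g}:=\begin{cases}\big(\{\xi\in\mathbb R^2: 0<|M\xi_1|/|\xi|<M_{\mathrm c},\ |\xi|<S(\xi)\}\cup\{\xi:\xi_1=0\}\big)\setminus\{\mathbf 0\}&\text{if }\bar{\mathbf M}=M\mathbf e_1,\\ \{\xi\in\mathbb R^2:|\xi|>|\xi|^M_{\mathrm{vc}}\}&\text{if }\bar{\mathbf M}=M\mathbf e_3.\end{cases}$$ Then for each $\xi\in\mathbb A^{\mathrm g}$ there exist $\lambda=\lambda(\xi)>0$ and a function $\psi=\psi(\xi,\cdot)\not\equiv0$ in $H^\infty(\mathbb R)=\bigcap_{k\ge0}H^k(\mathbb R)$ (hence smooth) that satisfy, on $\mathbb R$, $$-\lambda^2\big[\bar\rho|\xi|^2\psi-(\bar\rho\psi')'\big]=\lambda\mu\big(|\xi|^4\psi-2|\xi|^2\psi''+\psi''''\big)-g|\xi|^2\bar\rho'\psi+M^2\begin{cases}\xi_1^2(|\xi|^2\psi-\psi'')&\text{if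 }\bar{\mathbf M}=M\mathbf e_1,\\ \psi''''-|\xi|^2\psi''&\text{if }\bar{\mathbf M}=M\mathbf e_3,\end{cases}$$ together with $\psi(\pm\infty)=\psi'(\pm\infty)=0$ and the normalization $\int_{\mathbb R}\bar\rho\,(|\xi|^2|\psi|^2+|\psi'|^2)\,dx=1$. -/

import Mathlib

open MeasureTheory Filter Topology
open scoped ContDiff ENNReal

noncomputable section

/-- `f'` is the weak derivative of `f` on the real line, tested against `C_0^∞(ℝ)`. -/
def HasWeakDeriv (f f' : ℝ → ℝ) : Prop :=
  LocallyIntegrable f ∧ LocallyIntegrable f' ∧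
    ∀ φ : ℝ → ℝ, ContDiff ℝ ∞ φ → HasCompactSupport φ →
      ∫ x, f x * deriv φ x = -∫ x, f' x * φ x

/-- Membership in the Sobolev space `H^k(ℝ) = W^{k,2}(ℝ)` of real-valued functions. -/
def MemH : ℕ → (ℝ → ℝ) → Prop
  | 0, f => MemLp f 2
  | k + 1, f => MemLp f 2 ∧ ∃ f' : ℝ → ℝ, HasWeakDeriv f f' ∧ MemH k f'

/-- Membership in `H^∞(ℝ) = ⋂ₖ H^k(ℝ)`. -/
def MemHInfty (f : ℝ → ℝ) : Prop := ∀ k : ℕ, MemH k f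

/-- Smooth Rayleigh–Taylor density profiles: bounded, with compactly supported derivative, bounded
below by a positive constant, and increasing near some height. -/
structure IsRTProfile (ρ : ℝ → ℝ) : Prop where
  smooth : ContDiff ℝ ∞ ρ
  bounded : MemLp ρ ⊤
  compactSupport_deriv : HasCompactSupport (deriv ρ)
  inf_pos : ∃ c : ℝ, 0 < c ∧ ∀ x, c ≤ ρ x
  exists_deriv_pos : ∃ x, 0 < deriv ρ x

/-- The direction of the constant magnetic field: `M e₁` (horizontal) or `M e₃` (vertical). -/
inductive FieldDirection
  | horizontal
  | vertical

/-- The set of the quotients `∫ g ρ' |ψ|² / ∫ |ψ'|²` over `0 ≢ ψ ∈ H¹(ℝ)`. -/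
def criticalQuotients (g : ℝ) (ρ : ℝ → ℝ) : Set EReal :=
  {r | ∃ ψ ψ' : ℝ → ℝ, MemH 1 ψ ∧ HasWeakDeriv ψ ψ' ∧ ¬ ψ =ᵐ[volume] 0 ∧
    r = (((∫ x, g * deriv ρ x * ψ x ^ 2) / (∫ x, ψ' x ^ 2) : ℝ) : EReal)}

/-- The critical number `M_c ∈ [0, ∞]`, the square root of the supremum of the quotients (which is
positive for a Rayleigh–Taylor profile and may be infinite). -/
def criticalNumber (g : ℝ) (ρ : ℝ → ℝ) : ℝ≥0∞ :=
  (sSup (criticalQuotients g ρ)).toENNReal ^ (1 / 2 : ℝ)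

/-- The critical frequency function `S(ξ)` of the horizontal case. It is only used for `M ξ₁ ≠ 0`,
where the quotients are bounded above by `g |ξ|² sup |ρ'| / (M ξ₁)²`. -/
def criticalFrequency (g M : ℝ) (ρ : ℝ → ℝ) (ξ : EuclideanSpace ℝ (Fin 2)) : ℝ :=
  √(sSup {r : ℝ | ∃ ψ ψ' : ℝ → ℝ, MemH 1 ψ ∧ HasWeakDeriv ψ ψ' ∧ ¬ ψ =ᵐ[volume] 0 ∧
    r = (g * ‖ξ‖ ^ 2 * (∫ x, deriv ρ x * ψ x ^ 2) / (M * ξ 0) ^ 2 - ∫ x, ψ' x ^ 2) /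
      ∫ x, ψ x ^ 2})

/-- The critical frequency constant `|ξ|_vc^M` of the vertical case; it is only used for
`0 < |M| < M_c`, where the set of quotients is nonempty. -/
def verticalCriticalFrequency (g M : ℝ) (ρ : ℝ → ℝ) : ℝ :=
  √(sInf {r : ℝ | ∃ ψ ψ' ψ'' : ℝ → ℝ, MemH 2 ψ ∧ HasWeakDeriv ψ ψ' ∧ HasWeakDeriv ψ' ψ'' ∧
    0 < (∫ x, (g * deriv ρ x * ψ x ^ 2 - M ^ 2 * ψ' x ^ 2)) ∧
    r = (M ^ 2 * ∫ x, ψ'' x ^ 2) / ∫ x, (g * deriv ρ x * ψ x ^ 2 - M ^ 2 * ψ' x ^ 2)})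

/-- The solvable domain `𝔸^g` of horizontal frequencies. -/
def solvableDomain (g M : ℝ) (ρ : ℝ → ℝ) : FieldDirection → Set (EuclideanSpace ℝ (Fin 2))
  | .horizontal =>
      ({ξ | 0 < |ξ 0 * M| / ‖ξ‖ ∧ ENNReal.ofReal (|ξ 0 * M| / ‖ξ‖) < criticalNumber g ρ ∧
          ‖ξ‖ < criticalFrequency g M ρ ξ} ∪ {ξ | ξ 0 = 0}) \ {0}
  | .vertical => {ξ | verticalCriticalFrequency g M ρ < ‖ξ‖}

/-- The magnetic term of the ordinary differential equation, without the factor `M²`. -/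
def magneticTerm (ξ : EuclideanSpace ℝ (Fin 2)) (ψ : ℝ → ℝ) (x : ℝ) : FieldDirection → ℝ
  | .horizontal => ξ 0 ^ 2 * (‖ξ‖ ^ 2 * ψ x - iteratedDeriv 2 ψ x)
  | .vertical => iteratedDeriv 4 ψ x - ‖ξ‖ ^ 2 * iteratedDeriv 2 ψ x

/-- The fourth-order equation with eigenvalue parameter `lam`, in the classical sense on `ℝ`. -/
def SatisfiesODE (d : FieldDirection) (μ g M : ℝ) (ρ : ℝ → ℝ) (ξ : EuclideanSpace ℝ (Fin 2))
    (lam : ℝ) (ψ : ℝ → ℝ) : Prop :=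
  ∀ x : ℝ,
    -lam ^ 2 * (ρ x * ‖ξ‖ ^ 2 * ψ x - deriv (fun y => ρ y * deriv ψ y) x) =
      lam * μ * (‖ξ‖ ^ 4 * ψ x - 2 * ‖ξ‖ ^ 2 * iteratedDeriv 2 ψ x + iteratedDeriv 4 ψ x)
        - g * ‖ξ‖ ^ 2 * deriv ρ x * ψ x + M ^ 2 * magneticTerm ξ ψ x d

/-- `ψ` and its derivative vanish at `±∞`. -/
def VanishesAtInfinity (ψ : ℝ → ℝ) : Prop :=
  Tendsto ψ atBot (𝓝 0) ∧ Tendsto (deriv ψ) atBot (𝓝 0) ∧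
    Tendsto ψ atTop (𝓝 0) ∧ Tendsto (deriv ψ) atTop (𝓝 0)

/-- The admissible set `𝒜` of those `ψ ∈ H²(ℝ)` with `∫ ρ (|ξ|² |ψ|² + |ψ'|²) = 1`. -/
def admissibleSet (ρ : ℝ → ℝ) (ξ : EuclideanSpace ℝ (Fin 2)) : Set (ℝ → ℝ) :=
  {ψ | MemH 2 ψ ∧ ∃ ψ' : ℝ → ℝ, HasWeakDeriv ψ ψ' ∧
    ∫ x, ρ x * (‖ξ‖ ^ 2 * ψ x ^ 2 + ψ' x ^ 2) = 1}

end

/-! Multiplying the equation by ψ and integrating gives λ²N(ψ) + λμD(ψ) = E(ψ): N is the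
density-weighted kinetic form, D the viscous form, and E is buoyancy minus magnetic tension. Both
field directions fit one template: the magnetic operator is a₀ − a₁∂² + a₂∂⁴ with nonnegative
constants. The definition of the solvable domain says precisely that E is positive somewhere. The
critical quotients range over Sobolev functions; mollification increases none of the L² norms and
changes the compactly supported buoyancy integral arbitrarily little, so a strict inequality passes
to a C² function.

The growth rate is the largest λ > 0 at which Q_λ = λ²N + λμD − E fails to be positive
(`exists_threshold`). The set of such λ is nonempty because E is positive somewhere, and bounded
because E ≤ L·N. At the threshold Q_λ is nonnegative and its infimum on the H² unit sphere is zero.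
No fixed-point argument in λ is needed.

A minimizing sequence converges because Q_λ + ∫wf² is coercive on H², where w = g|ξ|²ρ' has compact
support (`exists_weak_solution`). Arzelà–Ascoli controls the w-term, and the parallelogram identity
then makes the sequence Cauchy in H². Coercivity keeps the limit nonzero, and Cauchy–Schwarz for the
nonnegative form Q_λ gives the weak Euler–Lagrange equation.

Finally, integrating the equation three times expresses ψ' through primitives of lower-order terms,
so ψ is smooth (`contDiff_of_weak_solution`). Differentiating the equation puts all derivatives in
L² (`memLp_two_iteratedDeriv_of_solution`), and the conditions at infinity follow. -/

/-! ### Square integrable functions on the line -/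

open Set ContinuousLinearMap in
/-- Young's inequality for the convolution of an integrable kernel with a square integrable
function. -/
theorem memLp_two_convolution {χ f : ℝ → ℝ} (hχ : Integrable χ) (hf : MemLp f 2)
    (hm : AEStronglyMeasurable (convolution χ f (lsmul ℝ ℝ) volume)) :
    MemLp (convolution χ f (lsmul ℝ ℝ) volume) 2 ∧
      ∫ x, convolution χ f (lsmul ℝ ℝ) volume x ^ 2 ≤ (∫ x, |χ x|) ^ 2 * ∫ x, f x ^ 2 := by
  set A := ∫ x, |χ x| with hA
  have hA0 : 0 ≤ A := integral_nonneg fun _ => abs_nonneg _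
  have hχa : Integrable (fun x => |χ x|) := hχ.abs
  have hf2 : Integrable (fun x => f x ^ 2) := hf.integrable_sq
  have hex := hχa.ae_convolution_exists (lsmul ℝ ℝ) hf2
  have hint := hχa.integrable_convolution (lsmul ℝ ℝ) hf2
  have hval := integral_convolution (lsmul ℝ ℝ) hχa hf2
  -- Cauchy–Schwarz for the measure |χ(t)| dt, to be integrated in x afterwards.
  have key : ∀ᵐ x, convolution χ f (lsmul ℝ ℝ) volume x ^ 2 ≤
      A * convolution (fun x => |χ x|) (fun x => f x ^ 2) (lsmul ℝ ℝ) volume x := by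
    filter_upwards [hex] with x hx
    have hx' : Integrable (fun t => |χ t| * f (x - t) ^ 2) := hx
    have hmeas : AEStronglyMeasurable (fun t => χ t * f (x - t)) := by
      refine hχ.aestronglyMeasurable.mul ?_
      exact hf.aestronglyMeasurable.comp_quasiMeasurePreserving
        (quasiMeasurePreserving_sub_left_of_right_invariant volume x)
    have hprod : Integrable (fun t => χ t * f (x - t)) := by
      refine (hχa.add hx').mono hmeas (ae_of_all _ fun t => ?_)
      have h1 : |f (x - t)| ≤ 1 + f (x - t) ^ 2 := by
        nlinarith [sq_abs (f (x - t)), abs_nonneg (f (x - t)), sq_nonneg (|f (x - t)| - 1)]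
      have h2 : 0 ≤ |χ t| + |χ t| * f (x - t) ^ 2 := by positivity
      simp only [Pi.add_apply, Real.norm_eq_abs, abs_mul]
      rw [abs_of_nonneg h2]
      nlinarith [mul_le_mul_of_nonneg_left h1 (abs_nonneg (χ t))]
    have hc : Integrable (fun t => |χ t| * |f (x - t)|) := by
      simpa [abs_mul] using hprod.abs
    set C := ∫ t, |χ t| * |f (x - t)|
    set B := ∫ t, |χ t| * f (x - t) ^ 2
    have hB : convolution (fun x => |χ x|) (fun x => f x ^ 2) (lsmul ℝ ℝ) volume x = B := rfl
    have hU : convolution χ f (lsmul ℝ ℝ) volume x = ∫ t, χ t * f (x - t) := rfl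
    rw [hB, hU]
    have hUC : |∫ t, χ t * f (x - t)| ≤ C := by
      simpa [abs_mul] using abs_integral_le_integral_abs (f := fun t => χ t * f (x - t))
    have hC0 : 0 ≤ C := (abs_nonneg _).trans hUC
    -- The integral of |χ(t)|(s − |f(x − t)|)² is a nonnegative quadratic in s, so its discriminant
    -- gives C² ≤ AB.
    have hd := discrim_le_zero (a := A) (b := -(2 * C)) (c := B) fun s => by
      have h0 : 0 ≤ ∫ t, |χ t| * (s - |f (x - t)|) ^ 2 :=
        integral_nonneg fun t => by positivity
      have he : (fun t => |χ t| * (s - |f (x - t)|) ^ 2) = fun t =>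
          (s * s) * |χ t| + (-(2 * s)) * (|χ t| * |f (x - t)|) + |χ t| * f (x - t) ^ 2 := by
        funext t
        rw [← sq_abs (f (x - t))]; ring
      rw [he, integral_add ((hχa.const_mul _).fun_add (hc.const_mul _)) hx',
        integral_add (hχa.const_mul _) (hc.const_mul _), integral_const_mul,
        integral_const_mul] at h0
      linarith
    unfold discrim at hd
    have : (∫ t, χ t * f (x - t)) ^ 2 ≤ C ^ 2 := by
      rw [← sq_abs]; gcongr
    nlinarith
  have hi : Integrable (fun x => convolution χ f (lsmul ℝ ℝ) volume x ^ 2) := by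
    refine (hint.const_mul A).mono (hm.pow 2) ?_
    filter_upwards [key] with x hx
    rw [Real.norm_eq_abs, Real.norm_eq_abs, abs_of_nonneg (sq_nonneg _)]
    exact hx.trans (le_abs_self _)
  refine ⟨(memLp_two_iff_integrable_sq hm).2 hi, ?_⟩
  calc _ ≤ _ := integral_mono_ae hi (hint.const_mul A) key
    _ = _ := by
      rw [integral_const_mul, hval, lsmul_apply, smul_eq_mul]; ring

/-- A bounded continuous multiple of a square integrable function is square integrable. -/
theorem memLp_two_bdd_mul {c f : ℝ → ℝ} (hc : Continuous c) {C : ℝ} (hC : ∀ x, |c x| ≤ C)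
    (hf : MemLp f 2) : MemLp (fun x => c x * f x) 2 := by
  refine MemLp.of_le_mul (c := C) hf (hc.aestronglyMeasurable.mul hf.aestronglyMeasurable)
    (ae_of_all _ fun x => ?_)
  rw [norm_mul]
  exact mul_le_mul_of_nonneg_right (hC x) (norm_nonneg _)

/-- Pointwise limits of functions with bounded `L²` norms are square integrable. -/
theorem memLp_two_of_tendsto {F : ℕ → ℝ → ℝ} {f : ℝ → ℝ} {C : ℝ} (hF : ∀ n, MemLp (F n) 2)
    (hC : ∀ n, ∫ x, F n x ^ 2 ≤ C) (hlim : ∀ x, Tendsto (fun n => F n x) atTop (𝓝 (f x))) :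
    MemLp f 2 ∧ ∫ x, f x ^ 2 ≤ C := by
  have hm : AEStronglyMeasurable f :=
    aestronglyMeasurable_of_tendsto_ae atTop (fun n => (hF n).aestronglyMeasurable)
      (ae_of_all _ hlim)
  have hC0 : 0 ≤ C := (integral_nonneg fun _ => sq_nonneg _).trans (hC 0)
  have hle : ∀ n, ∫⁻ x, ‖F n x ^ 2‖ₑ ≤ ENNReal.ofReal C := fun n => by
    rw [← ofReal_integral_norm_eq_lintegral_enorm (hF n).integrable_sq]
    refine ENNReal.ofReal_le_ofReal (le_trans (le_of_eq ?_) (hC n))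
    exact integral_congr_ae (ae_of_all _ fun x => by simp)
  -- Fatou's lemma.
  have hbound : ∫⁻ x, ‖f x ^ 2‖ₑ ≤ ENNReal.ofReal C :=
    (lintegral_enorm_le_liminf_of_tendsto (G := fun n x => F n x ^ 2)
      (ae_of_all _ fun x => (hlim x).pow 2)
      fun n => (hF n).integrable_sq.aestronglyMeasurable.aemeasurable.enorm).trans
      (liminf_le_of_frequently_le' (Frequently.of_forall hle))
  have hi : Integrable (fun x => f x ^ 2) :=
    ⟨hm.pow 2, hbound.trans_lt ENNReal.ofReal_lt_top⟩
  refine ⟨(memLp_two_iff_integrable_sq hm).2 hi, ?_⟩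
  rw [← ofReal_integral_norm_eq_lintegral_enorm hi, ENNReal.ofReal_le_ofReal_iff hC0] at hbound
  simpa using hbound

theorem tendsto_zero_of_sq_tendsto_zero {α : Type*} {f : α → ℝ} {l : Filter α}
    (h : Tendsto (fun x => f x ^ 2) l (𝓝 0)) : Tendsto f l (𝓝 0) := by
  have := (Real.continuous_sqrt.tendsto 0).comp h
  simp only [Function.comp_def, Real.sqrt_sq_eq_abs, Real.sqrt_zero] at this
  exact (tendsto_zero_iff_abs_tendsto_zero _).2 this

/-- The derivative 2ff' of f² is integrable, so f² has a limit, which must be zero since f² is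
integrable as well. -/
theorem tendsto_atBot_zero_of_memLp_two {f f' : ℝ → ℝ}
    (hd : ∀ x, HasDerivAt f (f' x) x) (hf : MemLp f 2) (hf' : MemLp f' 2) : Tendsto f atBot (𝓝 0) := by
  have hi : Integrable (fun x => 2 * f x * f' x) := by
    simpa [mul_assoc] using (hf.integrable_mul hf').const_mul 2
  exact tendsto_zero_of_sq_tendsto_zero <|
    tendsto_zero_of_hasDerivAt_of_integrableOn_Iic (a := 0) (f' := fun x => 2 * f x * f' x)
      (fun x _ => by simpa using (hd x).fun_pow 2) hi.integrableOn hf.integrable_sq.integrableOn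

theorem tendsto_atTop_zero_of_memLp_two {f f' : ℝ → ℝ}
    (hd : ∀ x, HasDerivAt f (f' x) x) (hf : MemLp f 2) (hf' : MemLp f' 2) : Tendsto f atTop (𝓝 0) := by
  have hi : Integrable (fun x => 2 * f x * f' x) := by
    simpa [mul_assoc] using (hf.integrable_mul hf').const_mul 2
  exact tendsto_zero_of_sq_tendsto_zero <|
    tendsto_zero_of_hasDerivAt_of_integrableOn_Ioi (a := 0) (f' := fun x => 2 * f x * f' x)
      (fun x _ => by simpa using (hd x).fun_pow 2) hi.integrableOn hf.integrable_sq.integrableOn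

/-- The one-dimensional Sobolev inequality. -/
theorem sq_le_integral_sq_add {f f' : ℝ → ℝ}
    (hd : ∀ x, HasDerivAt f (f' x) x) (hf : MemLp f 2) (hf' : MemLp f' 2) 
    (x : ℝ) : f x ^ 2 ≤ (∫ x, f x ^ 2) + ∫ x, f' x ^ 2 := by
  have hi : Integrable (fun x => 2 * f x * f' x) := by
    simpa [mul_assoc] using (hf.integrable_mul hf').const_mul 2
  have hlim : Tendsto (fun x => f x ^ 2) atBot (𝓝 0) := by
    simpa using (tendsto_atBot_zero_of_memLp_two hd hf hf').pow 2
  have hderiv : ∀ x, HasDerivAt (fun x => f x ^ 2) (2 * f x * f' x) x := fun x => by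
    simpa using (hd x).fun_pow 2
  have h := integral_Iic_of_hasDerivAt_of_tendsto (a := x)
    (hderiv x).continuousAt.continuousWithinAt (fun y _ => hderiv y) hi.integrableOn hlim
  rw [sub_zero] at h
  rw [← h, ← integral_add hf.integrable_sq hf'.integrable_sq]
  have hs := hf.integrable_sq.fun_add hf'.integrable_sq
  calc _ ≤ ∫ y in Set.Iic x, (f y ^ 2 + f' y ^ 2) :=
        integral_mono hi.integrableOn hs.integrableOn fun y => by
          simp only
          nlinarith [sq_nonneg (f y - f' y)]
    _ ≤ _ := setIntegral_le_integral hs (ae_of_all _ fun y => by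
          simp only [Pi.zero_apply]; positivity)

open ContinuousLinearMap in
/-- Integrals of a continuous square integrable function over `[x, x + h]`, as functions of `x`. -/
theorem memLp_two_integral_window {f : ℝ → ℝ} (hc : Continuous f) (hf : MemLp f 2) {h : ℝ}
    (hh : 0 ≤ h) :
    MemLp (fun x => ∫ s in x..x + h, f s) 2 ∧
      ∫ x, (∫ s in x..x + h, f s) ^ 2 ≤ h ^ 2 * ∫ x, f x ^ 2 := by
  -- With this half-open interval, χ(x − t) = 1 exactly when t lies in (x, x + h], the set over
  -- which the interval integral is taken.
  set χ : ℝ → ℝ := Set.indicator (Set.Ico (-h) 0) (fun _ => 1) with hχd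
  have hχ : Integrable χ := by
    rw [hχd, integrable_indicator_iff measurableSet_Ico]
    exact integrableOn_const (by simp)
  have hχi : ∫ x, |χ x| = h := by
    have : (fun x => |χ x|) = χ := by
      funext x
      exact abs_of_nonneg (Set.indicator_nonneg (fun _ _ => zero_le_one) x)
    rw [this, hχd, integral_indicator measurableSet_Ico]
    simp [hh]
  have hconv : convolution χ f (lsmul ℝ ℝ) volume = fun x => ∫ s in x..x + h, f s := by
    funext x
    rw [convolution_lsmul_swap]
    have : (fun t => χ (x - t) • f t) = Set.indicator (Set.Ioc x (x + h)) f := by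
      funext t
      by_cases ht : t ∈ Set.Ioc x (x + h)
      · rw [Set.indicator_of_mem ht, hχd, Set.indicator_of_mem, one_smul]
        constructor <;> linarith [ht.1, ht.2]
      · rw [Set.indicator_of_notMem ht, hχd, Set.indicator_of_notMem, zero_smul]
        intro h'
        exact ht ⟨by linarith [h'.2], by linarith [h'.1]⟩
    rw [this, integral_indicator measurableSet_Ioc,
      intervalIntegral.integral_of_le (by linarith)]
  have hcont : Continuous (fun x => ∫ s in x..x + h, f s) := by
    have : (fun x => ∫ s in x..x + h, f s) =
        fun x => (∫ s in (0 : ℝ)..x + h, f s) - ∫ s in (0 : ℝ)..x, f s := by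
      funext x
      rw [intervalIntegral.integral_interval_sub_left] <;> exact hc.intervalIntegrable _ _
    rw [this]
    have hp : Continuous fun x => ∫ s in (0 : ℝ)..x, f s :=
      intervalIntegral.continuous_primitive (fun a b => hc.intervalIntegrable a b) 0
    exact (hp.comp (continuous_id.add continuous_const)).sub hp
  have := memLp_two_convolution hχ hf (by rw [hconv]; exact hcont.aestronglyMeasurable)
  rwa [hconv, hχi] at this

/-- A function with a continuous square integrable derivative has square integrable differences. -/
theorem memLp_two_difference {f f' : ℝ → ℝ} (hd : ∀ x, HasDerivAt f (f' x) x)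
    (hc : Continuous f') (hf' : MemLp f' 2) {h : ℝ} (hh : 0 ≤ h) :
    MemLp (fun x => f (x + h) - f x) 2 ∧
      ∫ x, (f (x + h) - f x) ^ 2 ≤ h ^ 2 * ∫ x, f' x ^ 2 := by
  have he : (fun x => ∫ s in x..x + h, f' s) = fun x => f (x + h) - f x := by
    funext x
    exact intervalIntegral.integral_eq_sub_of_hasDerivAt (fun y _ => hd y)
      (hc.intervalIntegrable _ _)
  have := memLp_two_integral_window hc hf' hh
  simp only [fun x => congrFun he x] at this
  exact this

/-- If `f` and `f''` are square integrable, then so is `f'`. -/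
theorem memLp_two_deriv_of_second {f f' f'' : ℝ → ℝ} (hd : ∀ x, HasDerivAt f (f' x) x)
    (hd' : ∀ x, HasDerivAt f' (f'' x) x) (hc : Continuous f'') (hf : MemLp f 2)
    (hf'' : MemLp f'' 2) : MemLp f' 2 := by
  have hcf' : Continuous f' := continuous_iff_continuousAt.2 fun x => (hd' x).continuousAt
  have hshift : MemLp (fun x => f (x + 1)) 2 :=
    hf.comp_measurePreserving (measurePreserving_add_right volume 1)
  have hw := (memLp_two_integral_window hc.abs hf''.abs zero_le_one).1
  have hbound : MemLp (fun x => |f (x + 1) - f x| + ∫ s in x..x + 1, |f'' s|) 2 :=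
    (hshift.sub hf).abs.add hw
  refine hbound.mono hcf'.aestronglyMeasurable (ae_of_all _ fun x => ?_)
  have hw0 : 0 ≤ ∫ s in x..x + 1, |f'' s| :=
    intervalIntegral.integral_nonneg (by linarith) fun _ _ => abs_nonneg _
  -- At some y in (x, x + 1) the derivative equals f(x + 1) − f(x), and |f'(y) − f'(x)| is at most
  -- the integral of |f''| over the window. Both bounds are in L² as functions of x.
  obtain ⟨y, hy, hy'⟩ := exists_hasDerivAt_eq_slope f f' (by linarith : x < x + 1)
    (fun z _ => (hd z).continuousAt.continuousWithinAt) fun z _ => hd z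
  have hsub : |f' y - f' x| ≤ ∫ s in x..x + 1, |f'' s| := by
    rw [← intervalIntegral.integral_eq_sub_of_hasDerivAt (fun z _ => hd' z)
      (hc.intervalIntegrable _ _)]
    refine (intervalIntegral.abs_integral_le_integral_abs hy.1.le).trans ?_
    exact intervalIntegral.integral_mono_interval le_rfl hy.1.le hy.2.le
      (ae_of_all _ fun _ => abs_nonneg _) (hc.abs.intervalIntegrable _ _)
  simp only [add_sub_cancel_left, div_one] at hy'
  simp only [Real.norm_eq_abs]
  rw [abs_of_nonneg (add_nonneg (abs_nonneg _) hw0)]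
  have : |f' x| ≤ |f' y| + |f' y - f' x| := by
    have := abs_sub_abs_le_abs_sub (f' x) (f' y)
    rw [abs_sub_comm] at this
    linarith
  rw [← hy']
  linarith

/-! ### Weak derivatives -/

theorem hasWeakDeriv_of_hasDerivAt {f f' : ℝ → ℝ} (hd : ∀ x, HasDerivAt f (f' x) x)
    (hc : Continuous f') : HasWeakDeriv f f' := by
  have hcf : Continuous f := continuous_iff_continuousAt.2 fun x => (hd x).continuousAt
  refine ⟨hcf.locallyIntegrable, hc.locallyIntegrable, fun φ hφ hs => ?_⟩
  have hφ' : Continuous (deriv φ) := hφ.continuous_deriv (by simp)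
  refine integral_mul_deriv_eq_deriv_mul_of_integrable (fun x _ => hd x)
    (fun x _ => (hφ.differentiable (by simp)).differentiableAt.hasDerivAt) ?_ ?_ ?_
  · exact (hcf.mul hφ').integrable_of_hasCompactSupport hs.deriv.mul_left
  · exact (hc.mul hφ.continuous).integrable_of_hasCompactSupport hs.mul_left
  · exact (hcf.mul hφ.continuous).integrable_of_hasCompactSupport hs.mul_left

theorem HasWeakDeriv.ae_eq {f g h : ℝ → ℝ} (hg : HasWeakDeriv f g) (hh : HasWeakDeriv f h) :
    g =ᵐ[volume] h := by
  have key : ∀ᵐ x, (g - h) x = 0 := by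
    refine ae_eq_zero_of_integral_contDiff_smul_eq_zero (hg.2.1.sub hh.2.1) fun φ hφ hs => ?_
    have h1 := hg.2.2 φ hφ hs
    have h2 := hh.2.2 φ hφ hs
    have i1 := hg.2.1.integrable_smul_left_of_hasCompactSupport hφ.continuous hs
    have i2 := hh.2.1.integrable_smul_left_of_hasCompactSupport hφ.continuous hs
    simp only [Pi.sub_apply, smul_sub]
    rw [integral_sub i1 i2]
    simp only [smul_eq_mul, mul_comm (φ _)]
    linarith
  filter_upwards [key] with x hx
  exact sub_eq_zero.1 hx

theorem MemH.memLp_two {k : ℕ} {f : ℝ → ℝ} (h : MemH k f) : MemLp f 2 := by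
  cases k with
  | zero => exact h
  | succ k => exact h.1

theorem MemH.memLp_two_weakDeriv {k : ℕ} {f f' : ℝ → ℝ} (h : MemH (k + 1) f)
    (hw : HasWeakDeriv f f') : MemLp f' 2 := by
  obtain ⟨-, g, hg, hgk⟩ := h
  exact hgk.memLp_two.ae_eq (hg.ae_eq hw)

/-- The first derivative hidden in `MemH` agrees with the given one only almost everywhere. Since
the test integrals ignore null sets, its weak derivative is also one of the given function. -/
theorem MemH.memLp_two_weakDeriv_weakDeriv {k : ℕ} {f f' f'' : ℝ → ℝ} (h : MemH (k + 2) f)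
    (hw : HasWeakDeriv f f') (hw' : HasWeakDeriv f' f'') : MemLp f'' 2 := by
  obtain ⟨-, g, hg, -, g', hg', hgk⟩ := h
  have hae : g =ᵐ[volume] f' := hg.ae_eq hw
  have : HasWeakDeriv f' g' := by
    refine ⟨hw.2.1, hg'.2.1, fun φ hφ hs => ?_⟩
    rw [← hg'.2.2 φ hφ hs]
    refine integral_congr_ae ?_
    filter_upwards [hae] with x hx
    rw [hx]
  exact hgk.memLp_two.ae_eq (this.ae_eq hw')

/-! ### Twice differentiable representatives of H² -/

/-- Functions of class `C²` in `H²(ℝ)`. -/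
structure IsClassicalH2 (f : ℝ → ℝ) : Prop where
  contDiff : ContDiff ℝ 2 f
  memLp : MemLp f 2
  memLp_deriv : MemLp (deriv f) 2
  memLp_deriv_deriv : MemLp (deriv (deriv f)) 2

namespace IsClassicalH2

variable {f h : ℝ → ℝ}

theorem hasDerivAt (hf : IsClassicalH2 f) (x : ℝ) : HasDerivAt f (deriv f x) x :=
  (hf.contDiff.differentiable (by simp)).differentiableAt.hasDerivAt

theorem contDiff_deriv (hf : IsClassicalH2 f) : ContDiff ℝ 1 (deriv f) :=
  ((contDiff_succ_iff_deriv (n := 1)).1 hf.contDiff).2.2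

theorem hasDerivAt_deriv (hf : IsClassicalH2 f) (x : ℝ) :
    HasDerivAt (deriv f) (deriv (deriv f) x) x :=
  (hf.contDiff_deriv.differentiable (by simp)).differentiableAt.hasDerivAt

theorem continuous (hf : IsClassicalH2 f) : Continuous f := hf.contDiff.continuous

theorem continuous_deriv (hf : IsClassicalH2 f) : Continuous (deriv f) :=
  hf.contDiff_deriv.continuous

theorem continuous_deriv_deriv (hf : IsClassicalH2 f) : Continuous (deriv (deriv f)) :=
  hf.contDiff_deriv.continuous_deriv le_rfl

theorem deriv_lin (hf : IsClassicalH2 f) (hh : IsClassicalH2 h) (s t : ℝ) :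
    deriv (fun x => s * f x + t * h x) = fun x => s * deriv f x + t * deriv h x := by
  funext x
  exact (((hf.hasDerivAt x).const_mul s).add ((hh.hasDerivAt x).const_mul t)).deriv

theorem deriv_deriv_lin (hf : IsClassicalH2 f) (hh : IsClassicalH2 h) (s t : ℝ) :
    deriv (deriv (fun x => s * f x + t * h x)) =
      fun x => s * deriv (deriv f) x + t * deriv (deriv h) x := by
  rw [hf.deriv_lin hh]
  funext x
  exact (((hf.hasDerivAt_deriv x).const_mul s).add ((hh.hasDerivAt_deriv x).const_mul t)).deriv

theorem lin (hf : IsClassicalH2 f) (hh : IsClassicalH2 h) (s t : ℝ) :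
    IsClassicalH2 (fun x => s * f x + t * h x) where
  contDiff := (contDiff_const.mul hf.contDiff).add (contDiff_const.mul hh.contDiff)
  memLp := (hf.memLp.const_mul s).add (hh.memLp.const_mul t)
  memLp_deriv := by
    rw [hf.deriv_lin hh]
    exact (hf.memLp_deriv.const_mul s).add (hh.memLp_deriv.const_mul t)
  memLp_deriv_deriv := by
    rw [hf.deriv_deriv_lin hh]
    exact (hf.memLp_deriv_deriv.const_mul s).add (hh.memLp_deriv_deriv.const_mul t)

theorem of_hasCompactSupport (hf : ContDiff ℝ 2 f) (hs : HasCompactSupport f) :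
    IsClassicalH2 f := by
  have h1 : ContDiff ℝ 1 (deriv f) := ((contDiff_succ_iff_deriv (n := 1)).1 hf).2.2
  exact ⟨hf, hf.continuous.memLp_of_hasCompactSupport hs,
    h1.continuous.memLp_of_hasCompactSupport hs.deriv,
    (h1.continuous_deriv le_rfl).memLp_of_hasCompactSupport hs.deriv.deriv⟩

theorem memH_two (hf : IsClassicalH2 f) : MemH 2 f :=
  ⟨hf.memLp, deriv f, hasWeakDeriv_of_hasDerivAt hf.hasDerivAt hf.continuous_deriv,
    hf.memLp_deriv, deriv (deriv f),
    hasWeakDeriv_of_hasDerivAt hf.hasDerivAt_deriv hf.continuous_deriv_deriv,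
    hf.memLp_deriv_deriv⟩

end IsClassicalH2

/-! ### Mollification -/

section Mollification

open ContinuousLinearMap

/-- The derivative of a mollification is the mollification of the weak derivative. -/
theorem HasWeakDeriv.convolution_deriv {f f' η : ℝ → ℝ} (hw : HasWeakDeriv f f')
    (hη : ContDiff ℝ ∞ η) (hs : HasCompactSupport η) :
    convolution (deriv η) f (lsmul ℝ ℝ) volume = convolution η f' (lsmul ℝ ℝ) volume := by
  funext x
  rw [convolution_lsmul_swap, convolution_lsmul_swap]
  have hφ : ContDiff ℝ ∞ fun t => η (x - t) := hη.comp (contDiff_const.sub contDiff_id)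
  have hφs : HasCompactSupport fun t => η (x - t) :=
    hs.comp_homeomorph (Homeomorph.subLeft x)
  have hd : deriv (fun t => η (x - t)) = fun t => -deriv η (x - t) := by
    funext t
    exact deriv_comp_const_sub ..
  have := hw.2.2 _ hφ hφs
  simp only [hd, mul_neg, integral_neg, neg_inj] at this
  simpa only [smul_eq_mul, mul_comm] using this

/-- Elements of `H¹(ℝ)` are approximated by smooth functions without increasing the norms. -/
theorem exists_mollification {ψ ψ' : ℝ → ℝ} (hψ : MemLp ψ 2) (hψ' : MemLp ψ' 2)
    (hw : HasWeakDeriv ψ ψ') :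
    ∃ F : ℕ → ℝ → ℝ, (∀ n, IsClassicalH2 (F n)) ∧
      (∀ n, ∫ x, F n x ^ 2 ≤ ∫ x, ψ x ^ 2) ∧
      (∀ n, ∫ x, deriv (F n) x ^ 2 ≤ ∫ x, ψ' x ^ 2) ∧
      (∀ ψ'', MemLp ψ'' 2 → HasWeakDeriv ψ' ψ'' →
        ∀ n, ∫ x, deriv (deriv (F n)) x ^ 2 ≤ ∫ x, ψ'' x ^ 2) ∧
      ∀ w : ℝ → ℝ, Continuous w → HasCompactSupport w →
        Tendsto (fun n => ∫ x, w x * F n x ^ 2) atTop (𝓝 (∫ x, w x * ψ x ^ 2)) := by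
  let φ : ℕ → ContDiffBump (0 : ℝ) := fun n =>
    ⟨1 / ((n : ℝ) + 1), 2 * (1 / ((n : ℝ) + 1)), by positivity, by
      have : 0 < 1 / ((n : ℝ) + 1) := by positivity
      linarith⟩
  let η : ℕ → ℝ → ℝ := fun n => (φ n).normed volume
  have hη : ∀ n, ContDiff ℝ ∞ (η n) := fun n => (φ n).contDiff_normed
  have hη1 : ∀ n, ContDiff ℝ 1 (η n) := fun n => (hη n).of_le (by simp)
  have hηs : ∀ n, HasCompactSupport (η n) := fun n => (φ n).hasCompactSupport_normed
  have hηi : ∀ n, Integrable (η n) := fun n => (φ n).integrable_normed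
  have hηd : ∀ n, Integrable (deriv (η n)) := fun n =>
    ((hη n).continuous_deriv (by simp)).integrable_of_hasCompactSupport (hηs n).deriv
  have hη_one : ∀ n, ∫ x, |η n x| = 1 := fun n => by
    have : (fun x => |η n x|) = η n := by
      funext x
      exact abs_of_nonneg ((φ n).nonneg_normed x)
    rw [this]
    exact (φ n).integral_normed
  have hsm : ∀ n (u : ℝ → ℝ), LocallyIntegrable u →
      ContDiff ℝ ∞ (convolution (η n) u (lsmul ℝ ℝ) volume) := fun n u hu =>
    (hηs n).contDiff_convolution_left (n := ⊤) (lsmul ℝ ℝ) (hη n) hu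
  have young : ∀ n (u : ℝ → ℝ), LocallyIntegrable u → MemLp u 2 →
      MemLp (convolution (η n) u (lsmul ℝ ℝ) volume) 2 ∧
      ∫ x, convolution (η n) u (lsmul ℝ ℝ) volume x ^ 2 ≤ ∫ x, u x ^ 2 := fun n u hu hu2 => by
    have := memLp_two_convolution (hηi n) hu2 (hsm n u hu).continuous.aestronglyMeasurable
    rwa [hη_one, one_pow, one_mul] at this
  have hder : ∀ n (u u' : ℝ → ℝ), HasWeakDeriv u u' →
      deriv (convolution (η n) u (lsmul ℝ ℝ) volume) =
        convolution (η n) u' (lsmul ℝ ℝ) volume := fun n u u' h => by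
    rw [← h.convolution_deriv (hη n) (hηs n)]
    funext x
    exact ((hηs n).hasDerivAt_convolution_left (lsmul ℝ ℝ) (hη1 n) h.1 x).deriv
  let F : ℕ → ℝ → ℝ := fun n => convolution (η n) ψ (lsmul ℝ ℝ) volume
  have hF' : ∀ n, deriv (F n) = convolution (η n) ψ' (lsmul ℝ ℝ) volume := fun n =>
    hder n ψ ψ' hw
  have hFH : ∀ n, IsClassicalH2 (F n) := fun n => by
    refine ⟨(hsm n ψ hw.1).of_le (WithTop.coe_le_coe.2 le_top), (young n ψ hw.1 hψ).1, ?_, ?_⟩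
    · rw [hF']
      exact (young n ψ' hw.2.1 hψ').1
    · rw [hF']
      -- No second weak derivative of ψ is assumed here, so the derivative falls on the kernel; this
      -- gives square integrability without a uniform bound.
      have hd2 : deriv (convolution (η n) ψ' (lsmul ℝ ℝ) volume) =
          convolution (deriv (η n)) ψ' (lsmul ℝ ℝ) volume := by
        funext x
        exact ((hηs n).hasDerivAt_convolution_left (lsmul ℝ ℝ) (hη1 n) hw.2.1 x).deriv
      have hc : Continuous (deriv (convolution (η n) ψ' (lsmul ℝ ℝ) volume)) :=
        (hsm n ψ' hw.2.1).continuous_deriv (by simp)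
      rw [hd2] at hc ⊢
      exact (memLp_two_convolution (hηd n) hψ' hc.aestronglyMeasurable).1
  have hb0 : ∀ n, ∫ x, F n x ^ 2 ≤ ∫ x, ψ x ^ 2 := fun n => (young n ψ hw.1 hψ).2
  have hb1 : ∀ n, ∫ x, deriv (F n) x ^ 2 ≤ ∫ x, ψ' x ^ 2 := fun n => by
    rw [hF']
    exact (young n ψ' hw.2.1 hψ').2
  refine ⟨F, hFH, hb0, hb1, fun ψ'' hψ'' hw' n => ?_, fun w hwc hws => ?_⟩
  · rw [hF', hder n ψ' ψ'' hw']
    exact (young n ψ'' hw'.2.1 hψ'').2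
  · have hlim : ∀ᵐ x, Tendsto (fun n => F n x) atTop (𝓝 (ψ x)) := by
      refine ContDiffBump.ae_convolution_tendsto_right_of_locallyIntegrable (K := 2) (φ := φ) ?_
        (Eventually.of_forall fun n => le_rfl) hw.1
      have := tendsto_one_div_add_atTop_nhds_zero_nat (𝕜 := ℝ) |>.const_mul 2
      rwa [mul_zero] at this
    set C := (∫ x, ψ x ^ 2) + ∫ x, ψ' x ^ 2
    -- The Sobolev inequality bounds all mollifications by one constant, which supplies the
    -- dominating function |w|C.
    have hsup : ∀ n x, F n x ^ 2 ≤ C := fun n x =>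
      (sq_le_integral_sq_add (hFH n).hasDerivAt (hFH n).memLp (hFH n).memLp_deriv x).trans
        (add_le_add (hb0 n) (hb1 n))
    refine tendsto_integral_of_dominated_convergence (fun x => |w x| * C)
      (fun n => (hwc.mul ((hFH n).continuous.pow 2)).aestronglyMeasurable)
      ((hwc.integrable_of_hasCompactSupport hws).abs.mul_const C)
      (fun n => ae_of_all _ fun x => ?_) ?_
    · rw [norm_mul, Real.norm_eq_abs, Real.norm_eq_abs, abs_of_nonneg (sq_nonneg (F n x))]
      exact mul_le_mul_of_nonneg_left (hsup n x) (abs_nonneg _)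
    · filter_upwards [hlim] with x hx
      exact (hx.pow 2).const_mul _

end Mollification

/-! ### Smoothness of weak solutions and integrability of their derivatives -/

theorem quadratic_of_third_deriv_zero {F F₁ F₂ : ℝ → ℝ} (h₀ : ∀ x, HasDerivAt F (F₁ x) x)
    (h₁ : ∀ x, HasDerivAt F₁ (F₂ x) x) (h₂ : ∀ x, HasDerivAt F₂ 0 x) (x : ℝ) :
    F x = F 0 + F₁ 0 * x + F₂ 0 / 2 * x ^ 2 := by
  have e₂ : ∀ x, F₂ x = F₂ 0 := fun x =>
    is_const_of_deriv_eq_zero (fun y => (h₂ y).differentiableAt) (fun y => (h₂ y).deriv) x 0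
  have e₁ : ∀ x, F₁ x - F₂ 0 * x = F₁ 0 - F₂ 0 * 0 := fun x => by
    have hd : ∀ y, HasDerivAt (fun x => F₁ x - F₂ 0 * x) 0 y := fun y => by
      have := (h₁ y).fun_sub ((hasDerivAt_id' y).const_mul (F₂ 0))
      simpa [e₂ y] using this
    exact is_const_of_deriv_eq_zero (fun y => (hd y).differentiableAt) (fun y => (hd y).deriv) x 0
  have e₀ : F x - (F₁ 0 * x + F₂ 0 / 2 * x ^ 2) = F 0 - (F₁ 0 * 0 + F₂ 0 / 2 * 0 ^ 2) := by
    have hd : ∀ y, HasDerivAt (fun x => F x - (F₁ 0 * x + F₂ 0 / 2 * x ^ 2)) 0 y := fun y => by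
      have := (h₀ y).fun_sub (((hasDerivAt_id' y).const_mul (F₁ 0)).fun_add
        (((hasDerivAt_id' y).fun_pow 2).const_mul (F₂ 0 / 2)))
      refine this.congr_deriv ?_
      have := e₁ y
      simp only [mul_zero, sub_zero] at this
      norm_num
      linarith
    exact is_const_of_deriv_eq_zero (fun y => (hd y).differentiableAt) (fun y => (hd y).deriv) x 0
  simp at e₀
  linarith

open ContinuousLinearMap in
/-- A continuous function whose third distributional derivative vanishes is a quadratic
polynomial. -/
theorem quadratic_of_integral_third_deriv_eq_zero {W : ℝ → ℝ} (hW : Continuous W)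
    (h : ∀ φ : ℝ → ℝ, ContDiff ℝ ∞ φ → HasCompactSupport φ →
      ∫ x, W x * deriv (deriv (deriv φ)) x = 0) :
    ∃ a b c : ℝ, ∀ x, W x = a + b * x + c * x ^ 2 := by
  let φ : ℕ → ContDiffBump (0 : ℝ) := fun n =>
    ⟨1 / ((n : ℝ) + 1), 2 * (1 / ((n : ℝ) + 1)), by positivity, by
      have : 0 < 1 / ((n : ℝ) + 1) := by positivity
      linarith⟩
  have hr : Tendsto (fun n => (φ n).rOut) atTop (𝓝 0) := by
    have := tendsto_one_div_add_atTop_nhds_zero_nat (𝕜 := ℝ) |>.const_mul 2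
    rwa [mul_zero] at this
  have hWl := hW.locallyIntegrable (μ := volume)
  let V : ℕ → ℝ → ℝ := fun n => convolution ((φ n).normed volume) W (lsmul ℝ ℝ) volume
  have hV : ∀ x, Tendsto (fun n => V n x) atTop (𝓝 (W x)) :=
    ContDiffBump.convolution_tendsto_right_of_continuous hr hW
  -- The third derivative of a mollification at x is, up to sign, W tested against the third
  -- derivative of t ↦ η(x − t), hence zero.
  have hquad : ∀ n, ∃ a b c : ℝ, ∀ x, V n x = a + b * x + c * x ^ 2 := fun n => by
    set η := (φ n).normed volume
    have hη : ContDiff ℝ ∞ η := (φ n).contDiff_normed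
    have hη' := (contDiff_infty_iff_deriv.1 hη).2
    have hη'' := (contDiff_infty_iff_deriv.1 hη').2
    have hs : HasCompactSupport η := (φ n).hasCompactSupport_normed
    have hone : (1 : WithTop ℕ∞) ≤ ((⊤ : ℕ∞) : WithTop ℕ∞) := WithTop.coe_le_coe.2 le_top
    refine ⟨_, _, _, quadratic_of_third_deriv_zero
      (hs.hasDerivAt_convolution_left (lsmul ℝ ℝ) (hη.of_le hone) hWl)
      (hs.deriv.hasDerivAt_convolution_left (lsmul ℝ ℝ) (hη'.of_le hone) hWl) fun x => ?_⟩
    have h3 := hs.deriv.deriv.hasDerivAt_convolution_left (lsmul ℝ ℝ) (hη''.of_le hone) hWl x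
    refine h3.congr_deriv ?_
    rw [convolution_lsmul_swap]
    have hφ : ContDiff ℝ ∞ fun t => η (x - t) := hη.comp (contDiff_const.sub contDiff_id)
    have hφs : HasCompactSupport fun t => η (x - t) := hs.comp_homeomorph (Homeomorph.subLeft x)
    have hflip : ∀ u : ℝ → ℝ, deriv (fun t => u (x - t)) = fun t => -deriv u (x - t) := fun u => by
      funext t
      exact deriv_comp_const_sub ..
    have hneg : ∀ u : ℝ → ℝ, deriv (fun t => -u (x - t)) = fun t => deriv u (x - t) := fun u => by
      funext t
      rw [deriv.fun_neg, deriv_comp_const_sub, neg_neg]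
    have := h _ hφ hφs
    rw [hflip, hneg, hflip] at this
    simp only [mul_neg, integral_neg, neg_eq_zero] at this
    rw [← this]
    simp only [smul_eq_mul, mul_comm]
  -- Values at 0, 1 and −1 determine a quadratic polynomial, so pointwise convergence of the
  -- mollifications suffices to pass to the limit.
  have hid : ∀ n x, V n x = V n 0 + (V n 1 - V n (-1)) / 2 * x +
      ((V n 1 + V n (-1)) / 2 - V n 0) * x ^ 2 := fun n x => by
    obtain ⟨a, b, c, habc⟩ := hquad n
    rw [habc x, habc 0, habc 1, habc (-1)]
    ring
  refine ⟨W 0, (W 1 - W (-1)) / 2, (W 1 + W (-1)) / 2 - W 0, fun x => ?_⟩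
  refine tendsto_nhds_unique (hV x) ?_
  simp only [hid _ x]
  exact ((hV 0).add ((((hV 1).sub (hV (-1))).div_const 2).mul_const x)).add
    (((((hV 1).add (hV (-1))).div_const 2).sub (hV 0)).mul_const (x ^ 2))

theorem contDiff_succ_of_hasDerivAt {f f' : ℝ → ℝ} {n : ℕ} (hd : ∀ x, HasDerivAt f (f' x) x)
    (h : ContDiff ℝ n f') : ContDiff ℝ (n + 1 : ℕ) f := by
  have : deriv f = f' := funext fun x => (hd x).deriv
  push_cast
  exact contDiff_succ_iff_deriv.2 ⟨fun x => (hd x).differentiableAt, by simp, by rwa [this]⟩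

/-- Weak solutions of class `C¹` of a fourth-order equation with smooth coefficients are smooth
and solve the equation classically. -/
theorem contDiff_of_weak_solution {b : ℝ} (hb : b ≠ 0) {p q ψ ψ' : ℝ → ℝ} (hp : ContDiff ℝ ∞ p)
    (hq : ContDiff ℝ ∞ q) (hd : ∀ x, HasDerivAt ψ (ψ' x) x) (hc : Continuous ψ')
    (hweak : ∀ φ : ℝ → ℝ, ContDiff ℝ ∞ φ → HasCompactSupport φ →
      ∫ x, (-(b * ψ' x * deriv (deriv (deriv φ)) x) + p x * ψ' x * deriv φ x +
        q x * ψ x * φ x) = 0) :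
    ContDiff ℝ ∞ ψ ∧ ∀ x, b * iteratedDeriv 4 ψ x =
      deriv (fun y => p y * deriv ψ y) x - q x * ψ x := by
  have hcψ : Continuous ψ := continuous_iff_continuousAt.2 fun x => (hd x).continuousAt
  have prim : ∀ u : ℝ → ℝ, Continuous u →
      ∃ U : ℝ → ℝ, (∀ x, HasDerivAt U (u x) x) ∧ Continuous U := fun u hu =>
    ⟨fun x => ∫ t in (0 : ℝ)..x, u t, fun x => intervalIntegral.integral_hasDerivAt_right
      (hu.intervalIntegrable _ _) (hu.stronglyMeasurableAtFilter _ _) hu.continuousAt,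
      intervalIntegral.continuous_primitive (fun _ _ => hu.intervalIntegrable _ _) 0⟩
  -- Successive primitives Q' = qψ, H' = pψ' − Q, G' = H turn the weak equation into (G − bψ')''' =
  -- 0 in the sense of distributions.
  obtain ⟨Q, hQ, hQc⟩ := prim (fun x => q x * ψ x) (hq.continuous.mul hcψ)
  have hGc : Continuous fun x => p x * ψ' x - Q x := (hp.continuous.mul hc).sub hQc
  obtain ⟨H, hH, hHc⟩ := prim _ hGc
  obtain ⟨G, hG, hGc'⟩ := prim H hHc
  obtain ⟨α, β, γ, hW⟩ := quadratic_of_integral_third_deriv_eq_zero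
    (W := fun x => G x - b * ψ' x) (hGc'.sub (continuous_const.mul hc)) fun φ hφ hs => by
      have hφ1 := (contDiff_infty_iff_deriv.1 hφ).2
      have hφ2 := (contDiff_infty_iff_deriv.1 hφ1).2
      have hφ3 := (contDiff_infty_iff_deriv.1 hφ2).2
      have e1 := (hasWeakDeriv_of_hasDerivAt hQ (hq.continuous.mul hcψ)).2.2 φ hφ hs
      have e2 := (hasWeakDeriv_of_hasDerivAt hH hGc).2.2 _ hφ1 hs.deriv
      have e3 := (hasWeakDeriv_of_hasDerivAt hG hHc).2.2 _ hφ2 hs.deriv.deriv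
      have int : ∀ u v : ℝ → ℝ, Continuous u → Continuous v → HasCompactSupport v →
          Integrable (fun x => u x * v x) := fun u v hu hv hvs =>
        (hu.mul hv).integrable_of_hasCompactSupport hvs.mul_left
      have e0 := hweak φ hφ hs
      have i1 := int (fun x => b * ψ' x) _ (continuous_const.mul hc)
        hφ3.continuous hs.deriv.deriv.deriv
      have i2 := int (fun x => p x * ψ' x) _ (hp.continuous.mul hc) hφ1.continuous hs.deriv
      have i3 := int (fun x => q x * ψ x) _ (hq.continuous.mul hcψ) hφ.continuous hs
      have i4 := int _ _ hQc hφ1.continuous hs.deriv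
      have i5 := int _ _ hGc' hφ3.continuous hs.deriv.deriv.deriv
      rw [integral_add (i1.fun_neg.fun_add i2) i3, integral_add i1.fun_neg i2,
        integral_neg] at e0
      simp only at e1 e2
      have e2' : ∫ x, (p x * ψ' x - Q x) * deriv φ x =
          (∫ x, p x * ψ' x * deriv φ x) - ∫ x, Q x * deriv φ x := by
        rw [← integral_sub i2 i4]
        exact integral_congr_ae (ae_of_all _ fun x => by simp only; ring)
      have e5 : ∫ x, (G x - b * ψ' x) * deriv (deriv (deriv φ)) x =
          (∫ x, G x * deriv (deriv (deriv φ)) x) -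
            ∫ x, b * ψ' x * deriv (deriv (deriv φ)) x := by
        rw [← integral_sub i5 i1]
        exact integral_congr_ae (ae_of_all _ fun x => by simp only; ring)
      rw [e5]
      linarith
  have hψ' : ψ' = fun x => b⁻¹ * (G x - (α + β * x + γ * x ^ 2)) := by
    funext x
    have := hW x
    field_simp
    linarith
  -- Bootstrap: G is a double primitive of pψ' − Q, so the formula for ψ' gains one order of
  -- differentiability at each round.
  have hsm : ∀ n : ℕ, ContDiff ℝ (n + 1 : ℕ) ψ := by
    intro n
    induction n with
    | zero => exact contDiff_succ_of_hasDerivAt hd (contDiff_zero.2 hc)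
    | succ n ih =>
      have hdψ : deriv ψ = ψ' := funext fun x => (hd x).deriv
      have hψ'n : ContDiff ℝ n ψ' := by
        push_cast at ih
        rw [← hdψ]
        exact (contDiff_succ_iff_deriv.1 ih).2.2
      have hψn : ContDiff ℝ n ψ := ih.of_le (by exact_mod_cast n.le_succ)
      have hpn : ContDiff ℝ n p := contDiff_infty.1 hp n
      have hqn : ContDiff ℝ n q := contDiff_infty.1 hq n
      have hQn : ContDiff ℝ n Q :=
        (contDiff_succ_of_hasDerivAt hQ (hqn.mul hψn)).of_le (by exact_mod_cast n.le_succ)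
      have hHn := contDiff_succ_of_hasDerivAt hH ((hpn.mul hψ'n).sub hQn)
      have hGn : ContDiff ℝ (n + 1 : ℕ) G :=
        (contDiff_succ_of_hasDerivAt hG hHn).of_le (by exact_mod_cast (n + 1).le_succ)
      refine contDiff_succ_of_hasDerivAt hd ?_
      rw [hψ']
      fun_prop
  have hψ : ContDiff ℝ ∞ ψ :=
    contDiff_infty.2 fun n => (hsm n).of_le (by exact_mod_cast n.le_succ)
  refine ⟨hψ, fun x => ?_⟩
  have hdψ : deriv ψ = ψ' := funext fun x => (hd x).deriv
  have d2 : deriv ψ' = fun x => b⁻¹ * (H x - (β + γ * (2 * x))) := by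
    funext x
    have : HasDerivAt ψ' (b⁻¹ * (H x - (β + γ * (2 * x)))) x := by
      rw [hψ']
      refine HasDerivAt.const_mul _ ((hG x).sub ?_)
      have := (((hasDerivAt_id' x).const_mul β).const_add α).fun_add
        (((hasDerivAt_id' x).fun_pow 2).const_mul γ)
      simpa using this
    exact this.deriv
  have d3 : deriv (deriv ψ') = fun x => b⁻¹ * (p x * ψ' x - Q x - 2 * γ) := by
    funext x
    rw [d2]
    refine HasDerivAt.deriv (HasDerivAt.const_mul _ ((hH x).sub ?_))
    have := (((hasDerivAt_id x).const_mul 2).const_mul γ).const_add β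
    simpa [mul_comm] using this
  have hpψ : DifferentiableAt ℝ (fun y => p y * ψ' y) x := by
    have h1 : Differentiable ℝ ψ' := by
      rw [← hdψ]
      exact ((contDiff_infty_iff_deriv.1 hψ).2.differentiable (by simp))
    exact (hp.differentiable (by simp) x).mul (h1 x)
  have d4 : deriv (deriv (deriv ψ')) x =
      b⁻¹ * (deriv (fun y => p y * ψ' y) x - q x * ψ x) := by
    rw [d3]
    exact (HasDerivAt.const_mul _ ((hpψ.hasDerivAt.sub (hQ x)).sub_const (2 * γ))).deriv
  have h4 : iteratedDeriv 4 ψ = deriv (deriv (deriv (deriv ψ))) := by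
    simp only [iteratedDeriv_succ, iteratedDeriv_zero]
  rw [h4, hdψ, d4, mul_inv_cancel_left₀ hb]

/-- Multiplication by a smooth function with bounded derivatives preserves square integrability
of the derivatives. -/
theorem memLp_two_iteratedDeriv_mul {c f : ℝ → ℝ} (hc : ContDiff ℝ ∞ c) (hf : ContDiff ℝ ∞ f)
    (hb : ∀ n, ∃ C, ∀ x, |iteratedDeriv n c x| ≤ C) {n : ℕ}
    (h : ∀ j ≤ n, MemLp (iteratedDeriv j f) 2) :
    MemLp (iteratedDeriv n (fun x => c x * f x)) 2 := by
  have he : iteratedDeriv n (fun x => c x * f x) = fun x => ∑ i ∈ Finset.range (n + 1),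
      (n.choose i : ℝ) * (iteratedDeriv i c x * iteratedDeriv (n - i) f x) := by
    funext x
    have := iteratedDeriv_mul (n := n) (x := x) (contDiff_infty.1 hc n).contDiffAt
      (contDiff_infty.1 hf n).contDiffAt
    rw [← Pi.mul_def, this]
    exact Finset.sum_congr rfl fun i _ => mul_assoc _ _ _
  rw [he]
  refine memLp_finsetSum _ fun i _ => MemLp.const_mul ?_ _
  obtain ⟨C, hC⟩ := hb i
  exact memLp_two_bdd_mul (hc.continuous_iteratedDeriv i (by exact_mod_cast le_top)) hC
    (h _ (Nat.sub_le n i))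

theorem hasDerivAt_iteratedDeriv {f : ℝ → ℝ} (hf : ContDiff ℝ ∞ f) (n : ℕ) (x : ℝ) :
    HasDerivAt (iteratedDeriv n f) (iteratedDeriv (n + 1) f x) x := by
  rw [iteratedDeriv_succ]
  refine DifferentiableAt.hasDerivAt ?_
  exact (hf.differentiable_iteratedDeriv n (by exact_mod_cast ENat.natCast_lt_top n)) x

/-- Solutions in `H²` of a fourth-order equation with smooth bounded coefficients have square
integrable derivatives of all orders. -/
theorem memLp_two_iteratedDeriv_of_solution {b : ℝ} (hb : b ≠ 0) {p q ψ : ℝ → ℝ}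
    (hp : ContDiff ℝ ∞ p) (hq : ContDiff ℝ ∞ q)
    (hpb : ∀ n, ∃ C, ∀ x, |iteratedDeriv n p x| ≤ C)
    (hqb : ∀ n, ∃ C, ∀ x, |iteratedDeriv n q x| ≤ C) (hψ : ContDiff ℝ ∞ ψ)
    (hode : ∀ x, b * iteratedDeriv 4 ψ x = deriv (fun y => p y * deriv ψ y) x - q x * ψ x)
    (h2 : ∀ j ≤ 2, MemLp (iteratedDeriv j ψ) 2) (n : ℕ) : MemLp (iteratedDeriv n ψ) 2 := by
  have hψ' : ContDiff ℝ ∞ (deriv ψ) := (contDiff_infty_iff_deriv.1 hψ).2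
  have hpψ : ContDiff ℝ ∞ fun y => p y * deriv ψ y := hp.mul hψ'
  have hqψ : ContDiff ℝ ∞ fun y => q y * ψ y := hq.mul hψ
  -- The equation, differentiated n times, expresses order n + 4 through orders at most n + 2.
  have step : ∀ n, (∀ j ≤ n + 2, MemLp (iteratedDeriv j ψ) 2) →
      MemLp (iteratedDeriv (n + 4) ψ) 2 := by
    intro n hn
    have h4 : iteratedDeriv 4 ψ = fun x => b⁻¹ * (deriv (fun y => p y * deriv ψ y) x - q x * ψ x) := by
      funext x
      rw [← hode x, inv_mul_cancel_left₀ hb]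
    have he : iteratedDeriv (n + 4) ψ = fun x => b⁻¹ *
        (iteratedDeriv (n + 1) (fun y => p y * deriv ψ y) x -
          iteratedDeriv n (fun y => q y * ψ y) x) := by
      have : iteratedDeriv (n + 4) ψ = iteratedDeriv n (iteratedDeriv 4 ψ) := by
        simp only [iteratedDeriv_eq_iterate, Function.iterate_add_apply]
      rw [this, h4]
      funext x
      rw [iteratedDeriv_const_mul_field, iteratedDeriv_succ']
      congr 1
      exact iteratedDeriv_sub (contDiff_infty.1 (contDiff_infty_iff_deriv.1 hpψ).2 n).contDiffAt
        (contDiff_infty.1 hqψ n).contDiffAt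
    rw [he]
    refine MemLp.const_mul (MemLp.sub ?_ ?_) _
    · refine memLp_two_iteratedDeriv_mul hp hψ' hpb fun j hj => ?_
      rw [← iteratedDeriv_succ']
      exact hn _ (by omega)
    · exact memLp_two_iteratedDeriv_mul hq hψ hqb fun j hj => hn _ (by omega)
  -- The recursion starts at order four and never produces order three, which is interpolated
  -- between orders two and four.
  have h3 : MemLp (iteratedDeriv 3 ψ) 2 :=
    memLp_two_deriv_of_second (hasDerivAt_iteratedDeriv hψ 2) (hasDerivAt_iteratedDeriv hψ 3)
      (hψ.continuous_iteratedDeriv 4 (WithTop.coe_le_coe.2 le_top)) (h2 2 le_rfl) (step 0 h2)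
  induction n using Nat.strong_induction_on with
  | _ n ih =>
    rcases lt_or_ge n 4 with hn | hn
    · rcases Nat.lt_succ_iff_lt_or_eq.1 hn with h | rfl
      · exact h2 n (by omega)
      · exact h3
    · obtain ⟨m, rfl⟩ := Nat.exists_eq_add_of_le' hn
      exact step m fun j hj => ih j (by omega)

theorem memHInfty_of_memLp_iteratedDeriv {f : ℝ → ℝ} (hf : ContDiff ℝ ∞ f)
    (h : ∀ n, MemLp (iteratedDeriv n f) 2) : MemHInfty f := by
  intro k
  induction k generalizing f with
  | zero => simpa [MemH] using h 0
  | succ k ih =>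
    have hf' := (contDiff_infty_iff_deriv.1 hf).2
    refine ⟨by simpa using h 0, deriv f, hasWeakDeriv_of_hasDerivAt
      (fun x => (hf.differentiable (by simp) x).hasDerivAt) hf'.continuous, ih hf' fun n => ?_⟩
    rw [← iteratedDeriv_succ']
    exact h (n + 1)

/-! ### The threshold of the quadratic eigenvalue problem -/

/-- The largest parameter at which a quadratic eigenvalue problem loses positivity. -/
theorem exists_threshold {X : Type*} {V : Set X} {N D E T : X → ℝ} {μ C L : ℝ} (hμ : 0 < μ)
    (hC : 0 ≤ C) (hN : ∀ f ∈ V, 0 < N f) (hD : ∀ f ∈ V, 0 ≤ D f) (hT : ∀ f ∈ V, 0 ≤ T f)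
    (hNT : ∀ f ∈ V, N f ≤ C * T f) (hDT : ∀ f ∈ V, D f ≤ C * T f)
    (hE : ∀ f ∈ V, E f ≤ L * N f) {f₀ : X} (hf₀ : f₀ ∈ V) (hE₀ : 0 < E f₀) :
    ∃ lam : ℝ, 0 < lam ∧ (∀ f ∈ V, 0 ≤ lam ^ 2 * N f + lam * μ * D f - E f) ∧
      ∀ ε > 0, ∃ f ∈ V, lam ^ 2 * N f + lam * μ * D f - E f ≤ ε * T f := by
  set S : Set ℝ := {l | 0 < l ∧ ∃ f ∈ V, l ^ 2 * N f + l * μ * D f ≤ E f} with hS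
  have hne : ∃ l, l ∈ S := by
    have hA : 0 < N f₀ + μ * D f₀ := add_pos_of_pos_of_nonneg (hN _ hf₀)
      (mul_nonneg hμ.le (hD _ hf₀))
    -- For l ≤ 1 one has l²N + lμD ≤ l(N + μD), which the second entry of the minimum keeps below E.
    have hl : 0 < min 1 (E f₀ / (N f₀ + μ * D f₀)) := lt_min one_pos (div_pos hE₀ hA)
    refine ⟨_, hl, f₀, hf₀, ?_⟩
    set l := min 1 (E f₀ / (N f₀ + μ * D f₀))
    have h1 : l ≤ 1 := min_le_left _ _
    have h2 : l * (N f₀ + μ * D f₀) ≤ E f₀ := by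
      rw [← le_div_iff₀ hA]
      exact min_le_right _ _
    have h3 : l ^ 2 * N f₀ ≤ l * N f₀ := by
      refine mul_le_mul_of_nonneg_right ?_ (hN _ hf₀).le
      nlinarith
    linarith
  have hbdd : BddAbove S := by
    -- Membership forces l²N ≤ E ≤ LN, so l² ≤ L, and 2l ≤ 1 + l².
    refine ⟨1 + L, ?_⟩
    rintro l ⟨hl, f, hf, h⟩
    have h1 : l ^ 2 * N f ≤ L * N f := by
      have := mul_nonneg (mul_nonneg hl.le hμ.le) (hD f hf)
      linarith [hE f hf]
    have h2 : l ^ 2 ≤ L := le_of_mul_le_mul_right h1 (hN f hf)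
    nlinarith [sq_nonneg (l - 1)]
  obtain ⟨l₀, hl₀⟩ := hne
  have hpos : 0 < sSup S := hl₀.1.trans_le (le_csSup hbdd hl₀)
  refine ⟨sSup S, hpos, fun f hf => ?_, fun ε hε => ?_⟩
  · by_contra! hlt
    -- A negative value at the supremum would persist for slightly larger l, which would then belong
    -- to the set.
    have hcont : ContinuousAt (fun l : ℝ => l ^ 2 * N f + l * μ * D f - E f) (sSup S) := by
      fun_prop
    have hev : ∀ᶠ l in 𝓝[>] sSup S, l ^ 2 * N f + l * μ * D f - E f < 0 :=
      (hcont.eventually_lt_const hlt).filter_mono nhdsWithin_le_nhds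
    obtain ⟨l, hl, hgt⟩ := (hev.and self_mem_nhdsWithin).exists
    have hgt' : sSup S < l := hgt
    exact absurd (le_csSup hbdd ⟨hpos.trans hgt', f, hf, by linarith⟩) (not_le.2 hgt')
  · set R := sSup S
    have hA : 0 < (2 * R + μ) * C + 1 := by positivity
    -- Raising a nearly extremal l to R costs at most (R − l)(2R + μ)C·T(f). The summand 1 in the
    -- divisor keeps it positive even if C = 0.
    obtain ⟨l, ⟨hl, f, hf, hle⟩, hlt⟩ := exists_lt_of_lt_csSup ⟨l₀, hl₀⟩
      (sub_lt_self R (div_pos hε hA))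
    have hlR : l ≤ R := le_csSup hbdd ⟨hl, f, hf, hle⟩
    refine ⟨f, hf, ?_⟩
    have hδ : (R - l) * ((2 * R + μ) * C + 1) ≤ ε := by
      rw [← le_div_iff₀ hA]
      linarith
    have hT' := hT f hf
    have h1 : (R ^ 2 - l ^ 2) * N f ≤ (R - l) * (2 * R) * (C * T f) := by
      have : R ^ 2 - l ^ 2 ≤ (R - l) * (2 * R) := by nlinarith
      exact mul_le_mul this (hNT f hf) (hN f hf).le
        (mul_nonneg (by linarith) (by linarith))
    have h2 : (R - l) * μ * D f ≤ (R - l) * μ * (C * T f) :=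
      mul_le_mul_of_nonneg_left (hDT f hf) (mul_nonneg (by linarith) hμ.le)
    have h3 := mul_le_mul_of_nonneg_right hδ hT'
    have h4 : 0 ≤ (R - l) * T f := mul_nonneg (by linarith) hT'
    nlinarith

/-! ### Quadratic forms on H² -/

/-- The bilinear form `∫ b f'' h'' + p f' h' + q f h`. -/
noncomputable def bilinForm (b : ℝ) (p q f h : ℝ → ℝ) : ℝ :=
  ∫ x, (b * (deriv (deriv f) x * deriv (deriv h) x) + p x * (deriv f x * deriv h x) +
    q x * (f x * h x))

/-- The quadratic form `∫ b f''² + p f'² + q f²`. -/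
noncomputable def quadForm (b : ℝ) (p q f : ℝ → ℝ) : ℝ :=
  ∫ x, (b * deriv (deriv f) x ^ 2 + p x * deriv f x ^ 2 + q x * f x ^ 2)

/-- The squared norm of `H²(ℝ)`. -/
noncomputable def sobolevSq (f : ℝ → ℝ) : ℝ := quadForm 1 (fun _ => 1) (fun _ => 1) f

/-- Bounded continuous functions on the line. -/
def IsBddCont (c : ℝ → ℝ) : Prop := Continuous c ∧ ∃ C, ∀ x, |c x| ≤ C

theorem IsBddCont.integrable_mul {c f : ℝ → ℝ} (hc : IsBddCont c) (hf : Integrable f) :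
    Integrable (fun x => c x * f x) := by
  obtain ⟨hc, C, hC⟩ := hc
  exact hf.bdd_mul hc.aestronglyMeasurable (ae_of_all _ hC)

theorem isBddCont_const (c : ℝ) : IsBddCont fun _ => c := ⟨continuous_const, |c|, fun _ => le_rfl⟩

theorem IsBddCont.of_hasCompactSupport {c : ℝ → ℝ} (hc : Continuous c)
    (hs : HasCompactSupport c) : IsBddCont c := by
  obtain ⟨C, hC⟩ := hc.bounded_above_of_compact_support hs
  exact ⟨hc, C, hC⟩

section Forms

variable {b : ℝ} {p q f h : ℝ → ℝ}

theorem IsClassicalH2.integrable_quadForm (hf : IsClassicalH2 f) (hp : IsBddCont p)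
    (hq : IsBddCont q) :
    Integrable fun x => b * deriv (deriv f) x ^ 2 + p x * deriv f x ^ 2 + q x * f x ^ 2 :=
  ((hf.memLp_deriv_deriv.integrable_sq.const_mul b).fun_add
    (hp.integrable_mul hf.memLp_deriv.integrable_sq)).fun_add
    (hq.integrable_mul hf.memLp.integrable_sq)

theorem IsClassicalH2.integrable_bilinForm (hf : IsClassicalH2 f) (hh : IsClassicalH2 h)
    (hp : IsBddCont p) (hq : IsBddCont q) :
    Integrable fun x => b * (deriv (deriv f) x * deriv (deriv h) x) +
      p x * (deriv f x * deriv h x) + q x * (f x * h x) :=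
  (((hf.memLp_deriv_deriv.integrable_mul hh.memLp_deriv_deriv).const_mul b).fun_add
    (hp.integrable_mul (hf.memLp_deriv.integrable_mul hh.memLp_deriv))).fun_add
    (hq.integrable_mul (hf.memLp.integrable_mul hh.memLp))

theorem IsClassicalH2.quadForm_eq (hf : IsClassicalH2 f) (hp : IsBddCont p) (hq : IsBddCont q) :
    quadForm b p q f = b * (∫ x, deriv (deriv f) x ^ 2) + (∫ x, p x * deriv f x ^ 2) +
      ∫ x, q x * f x ^ 2 := by
  have i1 := hf.memLp_deriv_deriv.integrable_sq.const_mul b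
  have i2 := hp.integrable_mul hf.memLp_deriv.integrable_sq
  have i3 := hq.integrable_mul hf.memLp.integrable_sq
  rw [quadForm, integral_add (i1.fun_add i2) i3, integral_add i1 i2, integral_const_mul]

theorem IsClassicalH2.quadForm_lin (hf : IsClassicalH2 f) (hh : IsClassicalH2 h)
    (hp : IsBddCont p) (hq : IsBddCont q) (s t : ℝ) :
    quadForm b p q (fun x => s * f x + t * h x) =
      s ^ 2 * quadForm b p q f + 2 * s * t * bilinForm b p q f h + t ^ 2 * quadForm b p q h := by
  simp only [quadForm, bilinForm]
  rw [hf.deriv_deriv_lin hh, hf.deriv_lin hh, ← integral_const_mul, ← integral_const_mul,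
    ← integral_const_mul, ← integral_add, ← integral_add]
  · exact integral_congr_ae (ae_of_all _ fun x => by simp only; ring)
  · exact ((hf.integrable_quadForm hp hq).const_mul _).fun_add
      ((hf.integrable_bilinForm hh hp hq).const_mul _)
  · exact (hh.integrable_quadForm hp hq).const_mul _
  · exact (hf.integrable_quadForm hp hq).const_mul _
  · exact (hf.integrable_bilinForm hh hp hq).const_mul _

/-- The Cauchy–Schwarz inequality for a nonnegative form. -/
theorem IsClassicalH2.bilinForm_sq_le (hf : IsClassicalH2 f) (hh : IsClassicalH2 h)
    (hp : IsBddCont p) (hq : IsBddCont q)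
    (hnonneg : ∀ u, IsClassicalH2 u → 0 ≤ quadForm b p q u) :
    bilinForm b p q f h ^ 2 ≤ quadForm b p q f * quadForm b p q h := by
  have hd := discrim_le_zero (a := quadForm b p q h) (b := 2 * bilinForm b p q f h)
    (c := quadForm b p q f) fun t => by
      have := hnonneg _ (hf.lin hh 1 t)
      rw [hf.quadForm_lin hh hp hq] at this
      linarith
  unfold discrim at hd
  linarith

theorem IsClassicalH2.sobolevSq_eq (hf : IsClassicalH2 f) :
    sobolevSq f = (∫ x, deriv (deriv f) x ^ 2) + (∫ x, deriv f x ^ 2) + ∫ x, f x ^ 2 := by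
  rw [sobolevSq, hf.quadForm_eq (isBddCont_const 1) (isBddCont_const 1)]
  simp

theorem integral_sq_nonneg (f : ℝ → ℝ) : 0 ≤ ∫ x, f x ^ 2 := integral_nonneg fun _ => sq_nonneg _

theorem IsClassicalH2.sq_le_sobolevSq (hf : IsClassicalH2 f) (x : ℝ) :
    f x ^ 2 ≤ sobolevSq f := by
  rw [hf.sobolevSq_eq]
  linarith [sq_le_integral_sq_add hf.hasDerivAt hf.memLp hf.memLp_deriv x,
    integral_sq_nonneg (deriv (deriv f))]

theorem IsClassicalH2.deriv_sq_le_sobolevSq (hf : IsClassicalH2 f) (x : ℝ) :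
    deriv f x ^ 2 ≤ sobolevSq f := by
  rw [hf.sobolevSq_eq]
  linarith [sq_le_integral_sq_add hf.hasDerivAt_deriv hf.memLp_deriv hf.memLp_deriv_deriv x,
    integral_sq_nonneg f]

theorem IsClassicalH2.sobolevSq_pos (hf : IsClassicalH2 f) (h0 : f ≠ 0) : 0 < sobolevSq f := by
  obtain ⟨x, hx⟩ := Function.ne_iff.1 h0
  exact lt_of_lt_of_le (by have : f x ≠ 0 := hx; positivity) (hf.sq_le_sobolevSq x)

end Forms

/-! ### Compactness and the null vector -/

/-- Arzelà–Ascoli for uniformly bounded 1-Lipschitz functions on a compact interval. -/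
theorem exists_subseq_uniformCauchy_Icc {F : ℕ → ℝ → ℝ} (hF : ∀ n x, |F n x| ≤ 1)
    (hL : ∀ n x y, |F n x - F n y| ≤ |x - y|) (a b : ℝ) :
    ∃ σ : ℕ → ℕ, StrictMono σ ∧ ∀ ε > 0, ∃ N, ∀ m ≥ N, ∀ n ≥ N, ∀ x ∈ Set.Icc a b,
      |F (σ m) x - F (σ n) x| < ε := by
  have hc : ∀ n, Continuous (F n) := fun n =>
    (LipschitzWith.of_dist_le' (K := 1) fun x y => by
      simpa [Real.dist_eq] using hL n x y).continuous
  let G : ℕ → BoundedContinuousFunction (Set.Icc a b) ℝ := fun n =>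
    BoundedContinuousFunction.mkOfCompact ⟨fun x => F n x, (hc n).comp continuous_subtype_val⟩
  have hcomp : IsCompact (closure (Set.range G)) := by
    refine BoundedContinuousFunction.arzela_ascoli (Set.Icc (-1) 1) isCompact_Icc _ ?_ ?_
    · rintro _ x ⟨n, rfl⟩
      exact abs_le.1 (hF n x)
    · refine Metric.equicontinuous_of_continuity_modulus id tendsto_id _ ?_
      rintro x y ⟨_, n, rfl⟩
      exact hL n x y
  obtain ⟨u, -, σ, hσ, hlim⟩ := hcomp.tendsto_subseq fun n => subset_closure ⟨n, rfl⟩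
  refine ⟨σ, hσ, fun ε hε => ?_⟩
  obtain ⟨N, hN⟩ := Metric.cauchySeq_iff.1 hlim.cauchySeq ε hε
  refine ⟨N, fun m hm n hn x hx => ?_⟩
  exact (BoundedContinuousFunction.dist_coe_le_dist (f := G (σ m)) (g := G (σ n)) ⟨x, hx⟩).trans_lt
    (hN m hm n hn)

theorem abs_le_one_of_sq_le {a T : ℝ} (h : a ^ 2 ≤ T) (hT : T ≤ 1) : |a| ≤ 1 := by
  rw [← sq_le_one_iff_abs_le_one]
  linarith

/-- If each of a sequence of functions is uniformly close to the others, it converges uniformly. -/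
theorem exists_tendstoUniformly_of_cauchy {F : ℕ → ℝ → ℝ}
    (h : ∀ ε > 0, ∃ N, ∀ m ≥ N, ∀ n ≥ N, ∀ x, |F m x - F n x| < ε) :
    ∃ f, TendstoUniformly F f atTop := by
  have hcau : UniformCauchySeqOn F atTop Set.univ :=
    Metric.uniformCauchySeqOn_iff.2 fun ε hε => by
      obtain ⟨N, hN⟩ := h ε hε
      exact ⟨N, fun m hm n hn x _ => hN m hm n hn x⟩
  have hpt : ∀ x, ∃ y, Tendsto (fun n => F n x) atTop (𝓝 y) := fun x =>
    cauchySeq_tendsto_of_complete (Metric.cauchySeq_iff.2 fun ε hε => by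
      obtain ⟨N, hN⟩ := h ε hε
      exact ⟨N, fun m hm n hn => hN m hm n hn x⟩)
  choose f hf using hpt
  exact ⟨f, tendstoUniformlyOn_univ.1
    (hcau.tendstoUniformlyOn_of_tendsto fun x _ => hf x)⟩

/-- Existence of a null vector of a nonnegative form that is coercive up to a compact
perturbation and whose infimum on the unit sphere of `H²` is zero. -/
theorem exists_weak_solution {b c : ℝ} {p q w : ℝ → ℝ} (hc : 0 < c) (hp : IsBddCont p)
    (hq : IsBddCont q) (hw : Continuous w) (hws : HasCompactSupport w)
    (hcoer : ∀ f, IsClassicalH2 f → c * sobolevSq f ≤ quadForm b p q f + ∫ x, w x * f x ^ 2)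
    (hnonneg : ∀ f, IsClassicalH2 f → 0 ≤ quadForm b p q f)
    (hinf : ∀ ε > 0, ∃ f, IsClassicalH2 f ∧ f ≠ 0 ∧ quadForm b p q f ≤ ε * sobolevSq f) :
    ∃ ψ ψ' : ℝ → ℝ, (∀ x, HasDerivAt ψ (ψ' x) x) ∧ Continuous ψ' ∧ MemLp ψ 2 ∧ MemLp ψ' 2 ∧
      (∀ h ≥ 0, MemLp (fun x => ψ' (x + h) - ψ' x) 2 ∧
        ∫ x, (ψ' (x + h) - ψ' x) ^ 2 ≤ h ^ 2) ∧
      0 < (∫ x, w x * ψ x ^ 2) ∧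
      ∀ φ : ℝ → ℝ, ContDiff ℝ ∞ φ → HasCompactSupport φ →
        ∫ x, (-(b * ψ' x * deriv (deriv (deriv φ)) x) + p x * ψ' x * deriv φ x +
          q x * ψ x * φ x) = 0 := by
  have hnorm : ∀ n : ℕ, ∃ f, IsClassicalH2 f ∧ sobolevSq f = 1 ∧
      quadForm b p q f ≤ 1 / ((n : ℝ) + 1) := fun n => by
    obtain ⟨f, hf, hf0, hle⟩ := hinf (1 / ((n : ℝ) + 1)) (by positivity)
    have hT := hf.sobolevSq_pos hf0
    set T := sobolevSq f with hTd
    have hsq : (√T)⁻¹ ^ 2 = T⁻¹ := by rw [inv_pow, Real.sq_sqrt hT.le]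
    -- The zero summand presents the scalar multiple as a linear combination, so that `lin` and
    -- `quadForm_lin` apply.
    refine ⟨fun x => (√T)⁻¹ * f x + 0 * f x, hf.lin hf _ _, ?_, ?_⟩
    · rw [sobolevSq, hf.quadForm_lin hf (isBddCont_const 1) (isBddCont_const 1), hsq,
        ← sobolevSq, ← hTd]
      field_simp
      ring
    · rw [hf.quadForm_lin hf hp hq, hsq]
      have : T⁻¹ * quadForm b p q f ≤ T⁻¹ * (1 / ((n : ℝ) + 1) * T) :=
        mul_le_mul_of_nonneg_left hle (by positivity)
      have e : T⁻¹ * (1 / ((n : ℝ) + 1) * T) = 1 / ((n : ℝ) + 1) := by field_simp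
      rw [e] at this
      linarith
  choose F hF hF1 hFle using hnorm
  have hFb : ∀ n x, |F n x| ≤ 1 := fun n x =>
    abs_le_one_of_sq_le ((hF n).sq_le_sobolevSq x) (hF1 n).le
  have hFb' : ∀ n x, |deriv (F n) x| ≤ 1 := fun n x =>
    abs_le_one_of_sq_le ((hF n).deriv_sq_le_sobolevSq x) (hF1 n).le
  have hFL : ∀ n x y, |F n x - F n y| ≤ |x - y| := fun n x y => by
    have := Convex.norm_image_sub_le_of_norm_deriv_le (f := F n) (C := 1) (s := Set.univ)
      (fun z _ => ((hF n).hasDerivAt z).differentiableAt) (fun z _ => hFb' n z) convex_univ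
      (Set.mem_univ y) (Set.mem_univ x)
    simpa using this
  obtain ⟨R, hR⟩ := hws.isCompact.isBounded.subset_closedBall 0
  obtain ⟨σ, hσ, hσC⟩ := exists_subseq_uniformCauchy_Icc hFb hFL (-R) R
  set G : ℕ → ℝ → ℝ := fun n => F (σ n) with hGd
  have hG : ∀ n, IsClassicalH2 (G n) := fun n => hF (σ n)
  have hGle : ∀ n, quadForm b p q (G n) ≤ 1 / ((n : ℝ) + 1) := fun n => by
    refine (hFle (σ n)).trans ?_
    have : (n : ℝ) ≤ σ n := by exact_mod_cast hσ.id_le n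
    gcongr
  have hwi : Integrable w := hw.integrable_of_hasCompactSupport hws
  set A := ∫ x, |w x| with hA
  have hA0 : 0 ≤ A := integral_nonneg fun _ => abs_nonneg _
  -- Parallelogram identity: Q(Gₘ − Gₙ) = 2Q(Gₘ) + 2Q(Gₙ) − Q(Gₘ + Gₙ) ≤ 2Q(Gₘ) + 2Q(Gₙ), which is
  -- small. Uniform convergence on the support of w handles the remaining term in the coercivity
  -- estimate. The two contributions are at most cε/2 and cε/4.
  have hsmall : ∀ ε > 0, ∃ N, ∀ m ≥ N, ∀ n ≥ N,
      sobolevSq (fun x => 1 * G m x + (-1) * G n x) < ε := fun ε hε => by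
    set δ := √(c * ε / (4 * (A + 1))) with hδd
    have hδ2 : δ ^ 2 = c * ε / (4 * (A + 1)) := Real.sq_sqrt (by positivity)
    have hδ : 0 < δ := Real.sqrt_pos.2 (by positivity)
    obtain ⟨N₁, hN₁⟩ := hσC δ hδ
    obtain ⟨N₂, hN₂⟩ := exists_nat_one_div_lt (show 0 < c * ε / 8 by positivity)
    refine ⟨max N₁ N₂, fun m hm n hn => ?_⟩
    have hsub := (hG m).lin (hG n) 1 (-1)
    have hadd := (hG m).lin (hG n) 1 1
    have h1 := hcoer _ hsub
    have h2 := hnonneg _ hadd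
    rw [(hG m).quadForm_lin (hG n) hp hq] at h1 h2
    have hlt : ∀ k ≥ max N₁ N₂, quadForm b p q (G k) < c * ε / 8 := fun k hk => by
      refine ((hGle k).trans ?_).trans_lt hN₂
      have : (N₂ : ℝ) ≤ k := by exact_mod_cast (le_max_right _ _).trans hk
      gcongr
    have h3 := hlt m hm
    have h4 := hlt n hn
    have h5 : ∫ x, w x * (1 * G m x + (-1) * G n x) ^ 2 ≤ A * δ ^ 2 := by
      rw [hA, ← integral_mul_const]
      refine integral_mono ((IsBddCont.of_hasCompactSupport hw hws).integrable_mul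
        hsub.memLp.integrable_sq) (hwi.abs.mul_const _) fun x => ?_
      by_cases hx : x ∈ tsupport w
      · have hx' : x ∈ Set.Icc (-R) R := by
          have := hR hx
          rwa [Real.closedBall_eq_Icc, zero_sub, zero_add] at this
        have hd := (hN₁ m ((le_max_left _ _).trans hm) n ((le_max_left _ _).trans hn) x hx').le
        have hd2 : (1 * G m x + (-1) * G n x) ^ 2 ≤ δ ^ 2 := by
          rw [show 1 * G m x + (-1) * G n x = F (σ m) x - F (σ n) x by simp only [hGd]; ring,
            ← sq_abs]
          gcongr
        exact mul_le_mul (le_abs_self _) hd2 (sq_nonneg _) (abs_nonneg _)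
      · simp [image_eq_zero_of_notMem_tsupport hx]
    have h6 : A * δ ^ 2 ≤ c * ε / 4 := by
      rw [hδ2]
      have : A / (A + 1) ≤ 1 := (div_le_one (by positivity)).2 (by linarith)
      calc A * (c * ε / (4 * (A + 1))) = c * ε / 4 * (A / (A + 1)) := by field_simp
        _ ≤ c * ε / 4 * 1 := by gcongr
        _ = _ := mul_one _
    have h7 : c * sobolevSq (fun x => 1 * G m x + (-1) * G n x) < c * ε := by
      have : 0 < c * ε := by positivity
      linarith
    exact lt_of_mul_lt_mul_left h7 hc.le
  -- By the Sobolev inequality, Cauchy in H² implies uniformly Cauchy on the whole line, together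
  -- with first derivatives.
  have hclose : ∀ ε > 0, ∃ N, ∀ m ≥ N, ∀ n ≥ N, ∀ x,
      |G m x - G n x| < ε ∧ |deriv (G m) x - deriv (G n) x| < ε := fun ε hε => by
    obtain ⟨N, hN⟩ := hsmall (ε ^ 2) (by positivity)
    refine ⟨N, fun m hm n hn x => ?_⟩
    have hsub := (hG m).lin (hG n) 1 (-1)
    have h1 := (hsub.sq_le_sobolevSq x).trans_lt (hN m hm n hn)
    have h2 := (hsub.deriv_sq_le_sobolevSq x).trans_lt (hN m hm n hn)
    rw [(hG m).deriv_lin (hG n)] at h2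
    refine ⟨abs_lt_of_sq_lt_sq ?_ hε.le, abs_lt_of_sq_lt_sq ?_ hε.le⟩ <;> linarith
  obtain ⟨ψ, hψ⟩ := exists_tendstoUniformly_of_cauchy (F := G) fun ε hε =>
    (hclose ε hε).imp fun N hN m hm n hn x => (hN m hm n hn x).1
  obtain ⟨ψ', hψ'⟩ := exists_tendstoUniformly_of_cauchy (F := fun n => deriv (G n)) fun ε hε =>
    (hclose ε hε).imp fun N hN m hm n hn x => (hN m hm n hn x).2
  have hpt : ∀ x, Tendsto (fun n => G n x) atTop (𝓝 (ψ x)) := fun x => hψ.tendsto_at x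
  have hpt' : ∀ x, Tendsto (fun n => deriv (G n) x) atTop (𝓝 (ψ' x)) := fun x => hψ'.tendsto_at x
  have hGT : ∀ n, (∫ x, deriv (deriv (G n)) x ^ 2) + (∫ x, deriv (G n) x ^ 2) +
      (∫ x, G n x ^ 2) = 1 := fun n => by
    rw [← (hG n).sobolevSq_eq]
    exact hF1 (σ n)
  have hn0 : ∀ n, 0 ≤ ∫ x, G n x ^ 2 := fun n => integral_sq_nonneg _
  have hn1 : ∀ n, 0 ≤ ∫ x, deriv (G n) x ^ 2 := fun n => integral_sq_nonneg _
  have hn2 : ∀ n, 0 ≤ ∫ x, deriv (deriv (G n)) x ^ 2 := fun n => integral_sq_nonneg _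
  refine ⟨ψ, ψ', fun x => hasDerivAt_of_tendstoUniformly hψ'
      (Eventually.of_forall fun n y => (hG n).hasDerivAt y) hpt x,
    hψ'.continuous (Frequently.of_forall fun n => (hG n).continuous_deriv),
    (memLp_two_of_tendsto (C := 1) (fun n => (hG n).memLp)
      (fun n => by linarith [hGT n, hn1 n, hn2 n]) hpt).1,
    (memLp_two_of_tendsto (C := 1) (fun n => (hG n).memLp_deriv)
      (fun n => by linarith [hGT n, hn0 n, hn2 n]) hpt').1, fun h hh => ?_, ?_, ?_⟩
  -- Only C¹ regularity of the limit is known at this stage, so the bound on second derivatives is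
  -- passed on as a bound on differences of ψ'.
  · refine memLp_two_of_tendsto (F := fun n x => deriv (G n) (x + h) - deriv (G n) x)
      (fun n => (memLp_two_difference (hG n).hasDerivAt_deriv (hG n).continuous_deriv_deriv
        (hG n).memLp_deriv_deriv hh).1) (fun n => ?_) fun x => (hpt' (x + h)).sub (hpt' x)
    refine (memLp_two_difference (hG n).hasDerivAt_deriv (hG n).continuous_deriv_deriv
        (hG n).memLp_deriv_deriv hh).2.trans ?_
    exact mul_le_of_le_one_right (sq_nonneg _) (by linarith [hGT n, hn0 n, hn1 n])
  · have hlim : Tendsto (fun n => ∫ x, w x * G n x ^ 2) atTop (𝓝 (∫ x, w x * ψ x ^ 2)) := by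
      refine tendsto_integral_of_dominated_convergence (fun x => |w x|)
        (fun n => (hw.mul ((hG n).continuous.pow 2)).aestronglyMeasurable) hwi.abs
        (fun n => ae_of_all _ fun x => ?_)
        (ae_of_all _ fun x => ((hpt x).pow 2).const_mul _)
      rw [norm_mul, norm_pow]
      exact mul_le_of_le_one_right (norm_nonneg _) (pow_le_one₀ (norm_nonneg _) (hFb (σ n) x))
    -- Nothing is lost at infinity: coercivity at unit norm keeps the w-integral near or above c, so
    -- the limit cannot vanish.
    have hge : ∀ n : ℕ, c - 1 / ((n : ℝ) + 1) ≤ ∫ x, w x * G n x ^ 2 := fun n => by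
      have h1 := hcoer _ (hG n)
      rw [show sobolevSq (G n) = 1 from hF1 (σ n), mul_one] at h1
      linarith [hGle n]
    have hlim' : Tendsto (fun n : ℕ => c - 1 / ((n : ℝ) + 1)) atTop (𝓝 (c - 0)) :=
      tendsto_const_nhds.sub tendsto_one_div_add_atTop_nhds_zero_nat
    have := le_of_tendsto_of_tendsto' hlim' hlim hge
    linarith
  · intro φ hφ hs
    have hφ1 := (contDiff_infty_iff_deriv.1 hφ).2
    have hφ2 := (contDiff_infty_iff_deriv.1 hφ1).2
    have hφ3 := (contDiff_infty_iff_deriv.1 hφ2).2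
    have hφH : IsClassicalH2 φ :=
      .of_hasCompactSupport (hφ.of_le (WithTop.coe_le_coe.2 le_top)) hs
    have icc : ∀ u v : ℝ → ℝ, Continuous u → Continuous v → HasCompactSupport v →
        Integrable (fun x => u x * v x) := fun u v hu hv hvs =>
      (hu.mul hv).integrable_of_hasCompactSupport hvs.mul_left
    -- One integration by parts removes the second derivative of Gₙ, leaving only quantities that
    -- converge pointwise.
    have hbil : ∀ n, bilinForm b p q (G n) φ =
        ∫ x, (-(b * deriv (G n) x * deriv (deriv (deriv φ)) x) + p x * deriv (G n) x * deriv φ x +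
          q x * G n x * φ x) := fun n => by
      have i1 := icc (fun x => b * deriv (deriv (G n)) x) _
        (continuous_const.mul (hG n).continuous_deriv_deriv) hφ2.continuous hs.deriv.deriv
      have i1' := icc (fun x => b * deriv (G n) x) _
        (continuous_const.mul (hG n).continuous_deriv) hφ3.continuous hs.deriv.deriv.deriv
      have i2 := icc (fun x => p x * deriv (G n) x) _
        (hp.1.mul (hG n).continuous_deriv) hφ1.continuous hs.deriv
      have i3 := icc (fun x => q x * G n x) _ (hq.1.mul (hG n).continuous) hφ.continuous hs
      have ibp := (hasWeakDeriv_of_hasDerivAt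
        (fun x => ((hG n).hasDerivAt_deriv x).const_mul b)
        (continuous_const.mul (hG n).continuous_deriv_deriv)).2.2 _ hφ2 hs.deriv.deriv
      rw [integral_add (i1'.fun_neg.fun_add i2) i3, integral_add i1'.fun_neg i2, integral_neg,
        ibp, neg_neg, ← integral_add i1 i2, ← integral_add (i1.fun_add i2) i3, bilinForm]
      exact integral_congr_ae (ae_of_all _ fun x => by simp only; ring)
    have hzero : Tendsto (fun n => bilinForm b p q (G n) φ) atTop (𝓝 0) := by
      refine tendsto_zero_of_sq_tendsto_zero ?_
      have hub : Tendsto (fun n : ℕ => 1 / ((n : ℝ) + 1) * quadForm b p q φ) atTop (𝓝 0) := by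
        simpa using (tendsto_one_div_add_atTop_nhds_zero_nat (𝕜 := ℝ)).mul_const
          (quadForm b p q φ)
      refine squeeze_zero (fun n => sq_nonneg _) (fun n => ?_) hub
      -- Cauchy–Schwarz for the nonnegative form: a minimizing sequence is asymptotically orthogonal
      -- to every test function.
      exact ((hG n).bilinForm_sq_le hφH hp hq hnonneg).trans
        (mul_le_mul_of_nonneg_right (hGle n) (hnonneg φ hφH))
    refine tendsto_nhds_unique ?_ hzero
    simp only [hbil]
    refine tendsto_integral_of_dominated_convergence
      (fun x => |b| * |deriv (deriv (deriv φ)) x| + |p x| * |deriv φ x| + |q x| * |φ x|)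
      (fun n => ?_) ?_ (fun n => ae_of_all _ fun x => ?_) (ae_of_all _ fun x => ?_)
    · have h1 := (hG n).continuous_deriv
      have h2 := (hG n).continuous
      have h3 := hφ3.continuous
      have h4 := hφ1.continuous
      have h5 := hφ.continuous
      have h6 := hp.1
      have h7 := hq.1
      exact Continuous.aestronglyMeasurable (by fun_prop)
    · have j1 := (icc (fun _ => b) _ continuous_const hφ3.continuous hs.deriv.deriv.deriv).abs
      have j2 := (icc p _ hp.1 hφ1.continuous hs.deriv).abs
      have j3 := (icc q _ hq.1 hφ.continuous hs).abs
      simp only [abs_mul] at j1 j2 j3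
      exact (j1.fun_add j2).fun_add j3
    · rw [Real.norm_eq_abs]
      refine (abs_add_three _ _ _).trans ?_
      rw [abs_neg]
      simp only [abs_mul]
      have h1 : |deriv (G n) x| ≤ 1 := hFb' (σ n) x
      have h2 : |G n x| ≤ 1 := hFb (σ n) x
      gcongr
      · exact mul_le_of_le_one_right (abs_nonneg _) h1
      · exact mul_le_of_le_one_right (abs_nonneg _) h1
      · exact mul_le_of_le_one_right (abs_nonneg _) h2
    · exact ((((hpt' x).const_mul b).mul_const _).neg.add
        (((hpt' x).const_mul _).mul_const _)).add (((hpt x).const_mul _).mul_const _)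

/-! ### The second derivative of the limit, and the algebra of forms and coefficients -/

/-- A smooth function whose derivative has difference quotients bounded in `L²` has a square
integrable second derivative. -/
theorem memLp_two_second_deriv {ψ' ψ'' : ℝ → ℝ} (hd : ∀ x, HasDerivAt ψ' (ψ'' x) x)
    (h : ∀ h ≥ 0, MemLp (fun x => ψ' (x + h) - ψ' x) 2 ∧
      ∫ x, (ψ' (x + h) - ψ' x) ^ 2 ≤ h ^ 2) : MemLp ψ'' 2 := by
  refine (memLp_two_of_tendsto (C := 1)
    (F := fun n x => ((n : ℝ) + 1) * (ψ' (x + 1 / ((n : ℝ) + 1)) - ψ' x)) (fun n => ?_)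
    (fun n => ?_) fun x => ?_).1
  · exact (h _ (by positivity)).1.const_mul _
  · have := (h (1 / ((n : ℝ) + 1)) (by positivity)).2
    simp only [mul_pow]
    rw [integral_const_mul]
    calc _ ≤ ((n : ℝ) + 1) ^ 2 * (1 / ((n : ℝ) + 1)) ^ 2 := by gcongr
      _ = 1 := by field_simp
  · have hs := (hasDerivAt_iff_tendsto_slope_zero.1 (hd x))
    have hseq : Tendsto (fun n : ℕ => 1 / ((n : ℝ) + 1)) atTop (𝓝[≠] 0) := by
      refine tendsto_nhdsWithin_iff.2 ⟨tendsto_one_div_add_atTop_nhds_zero_nat,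
        Eventually.of_forall fun n => ?_⟩
      have : (0 : ℝ) < 1 / ((n : ℝ) + 1) := by positivity
      exact this.ne'
    simpa [Function.comp_def] using hs.comp hseq

theorem const_mul_quadForm (c b : ℝ) (p q f : ℝ → ℝ) :
    c * quadForm b p q f = quadForm (c * b) (fun x => c * p x) (fun x => c * q x) f := by
  simp only [quadForm]
  rw [← integral_const_mul]
  exact integral_congr_ae (ae_of_all _ fun x => by simp only; ring)

theorem IsClassicalH2.quadForm_add {b b' : ℝ} {p p' q q' f : ℝ → ℝ} (hf : IsClassicalH2 f)
    (hp : IsBddCont p) (hp' : IsBddCont p') (hq : IsBddCont q) (hq' : IsBddCont q') :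
    quadForm b p q f + quadForm b' p' q' f =
      quadForm (b + b') (fun x => p x + p' x) (fun x => q x + q' x) f := by
  simp only [quadForm]
  rw [← integral_add (hf.integrable_quadForm hp hq) (hf.integrable_quadForm hp' hq')]
  exact integral_congr_ae (ae_of_all _ fun x => by simp only; ring)

theorem IsClassicalH2.quadForm_mono {b b' : ℝ} {p p' q q' f : ℝ → ℝ} (hf : IsClassicalH2 f)
    (hp : IsBddCont p) (hp' : IsBddCont p') (hq : IsBddCont q) (hq' : IsBddCont q')
    (hb : b ≤ b') (hpp : ∀ x, p x ≤ p' x) (hqq : ∀ x, q x ≤ q' x) :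
    quadForm b p q f ≤ quadForm b' p' q' f := by
  refine integral_mono (hf.integrable_quadForm hp hq) (hf.integrable_quadForm hp' hq')
    fun x => ?_
  have := hpp x
  have := hqq x
  simp only
  gcongr

theorem IsBddCont.const_mul {c : ℝ → ℝ} (hc : IsBddCont c) (a : ℝ) :
    IsBddCont fun x => a * c x := by
  obtain ⟨hc, C, hC⟩ := hc
  refine ⟨continuous_const.mul hc, |a| * C, fun x => ?_⟩
  rw [abs_mul]
  exact mul_le_mul_of_nonneg_left (hC x) (abs_nonneg _)

theorem IsBddCont.add {c d : ℝ → ℝ} (hc : IsBddCont c) (hd : IsBddCont d) :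
    IsBddCont fun x => c x + d x := by
  obtain ⟨hc, C, hC⟩ := hc
  obtain ⟨hd, D, hD⟩ := hd
  exact ⟨hc.add hd, C + D, fun x => (abs_add_le _ _).trans (add_le_add (hC x) (hD x))⟩

/-- Smooth functions that are bounded together with all their derivatives. -/
def IsBddSmooth (c : ℝ → ℝ) : Prop :=
  ContDiff ℝ ∞ c ∧ ∀ n, ∃ C, ∀ x, |iteratedDeriv n c x| ≤ C

theorem IsBddSmooth.isBddCont {c : ℝ → ℝ} (hc : IsBddSmooth c) : IsBddCont c :=
  ⟨hc.1.continuous, by simpa using hc.2 0⟩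

theorem IsBddSmooth.add {c d : ℝ → ℝ} (hc : IsBddSmooth c) (hd : IsBddSmooth d) :
    IsBddSmooth fun x => c x + d x := by
  refine ⟨hc.1.add hd.1, fun n => ?_⟩
  obtain ⟨C, hC⟩ := hc.2 n
  obtain ⟨D, hD⟩ := hd.2 n
  refine ⟨C + D, fun x => ?_⟩
  have : iteratedDeriv n (fun x => c x + d x) x = iteratedDeriv n c x + iteratedDeriv n d x :=
    iteratedDeriv_add (contDiff_infty.1 hc.1 n).contDiffAt (contDiff_infty.1 hd.1 n).contDiffAt
  rw [this]
  exact (abs_add_le _ _).trans (add_le_add (hC x) (hD x))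

theorem IsBddSmooth.const_mul {c : ℝ → ℝ} (hc : IsBddSmooth c) (a : ℝ) :
    IsBddSmooth fun x => a * c x := by
  refine ⟨contDiff_const.mul hc.1, fun n => ?_⟩
  obtain ⟨C, hC⟩ := hc.2 n
  refine ⟨|a| * C, fun x => ?_⟩
  rw [iteratedDeriv_const_mul_field, abs_mul]
  exact mul_le_mul_of_nonneg_left (hC x) (abs_nonneg _)

theorem iteratedDeriv_hasCompactSupport {c : ℝ → ℝ} (hs : HasCompactSupport c) (n : ℕ) :
    HasCompactSupport (iteratedDeriv n c) := by
  induction n with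
  | zero => simpa using hs
  | succ n ih =>
    rw [iteratedDeriv_succ]
    exact ih.deriv

theorem isBddSmooth_of_hasCompactSupport {c : ℝ → ℝ} (hc : ContDiff ℝ ∞ c)
    (hs : HasCompactSupport c) : IsBddSmooth c :=
  ⟨hc, fun n => (IsBddCont.of_hasCompactSupport
    (hc.continuous_iteratedDeriv n (by exact_mod_cast le_top))
    (iteratedDeriv_hasCompactSupport hs n)).2⟩

theorem isBddSmooth_const (a : ℝ) : IsBddSmooth fun _ => a := by
  refine ⟨contDiff_const, fun n => ⟨|a|, fun x => ?_⟩⟩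
  rw [iteratedDeriv_const]
  split <;> simp

/-- The essential bound holds everywhere, since by continuity the exceptional set is open and null,
hence empty. Higher orders are derivatives of the compactly supported ρ'. -/
theorem IsRTProfile.isBddSmooth {ρ : ℝ → ℝ} (hρ : IsRTProfile ρ) : IsBddSmooth ρ := by
  refine ⟨hρ.smooth, fun n => ?_⟩
  cases n with
  | zero =>
    set C := (eLpNormEssSup ρ volume).toReal
    have hfin : eLpNormEssSup ρ volume ≠ ⊤ := by
      have := hρ.bounded.2.ne
      rwa [eLpNorm_exponent_top] at this
    have hae : ∀ᵐ x, |ρ x| ≤ C := by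
      filter_upwards [ae_le_eLpNormEssSup (f := ρ) (μ := volume)] with x hx
      have := ENNReal.toReal_mono hfin hx
      simpa using this
    refine ⟨C, fun x => ?_⟩
    have hopen : IsOpen {x | ¬ |ρ x| ≤ C} := by
      simp only [not_le]
      exact isOpen_lt continuous_const hρ.smooth.continuous.abs
    have hempty := (hopen.measure_eq_zero_iff volume).1 (ae_iff.1 hae)
    by_contra hx
    have : x ∈ {x | ¬ |ρ x| ≤ C} := hx
    rwa [hempty] at this
  | succ n =>
    obtain ⟨C, hC⟩ := (isBddSmooth_of_hasCompactSupport (contDiff_infty_iff_deriv.1 hρ.smooth).2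
      hρ.compactSupport_deriv).2 n
    exact ⟨C, by rwa [iteratedDeriv_succ']⟩

/-- The lower bound on ρ leaves a positive combination of ∫f² and ∫f'², which cannot both vanish by
the Sobolev inequality at a point where f ≠ 0. -/
theorem IsRTProfile.quadForm_pos {ρ : ℝ → ℝ} (hρ : IsRTProfile ρ) {k : ℝ} (hk : 0 < k)
    {f : ℝ → ℝ} (hf : IsClassicalH2 f) (hf0 : f ≠ 0) :
    0 < quadForm 0 ρ (fun x => k ^ 2 * ρ x) f := by
  have hρb := hρ.isBddSmooth.isBddCont
  obtain ⟨c, hc, hcρ⟩ := hρ.inf_pos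
  have hk2 : 0 < k ^ 2 := by positivity
  refine lt_of_lt_of_le ?_ (hf.quadForm_mono (isBddCont_const c) hρb (isBddCont_const (k ^ 2 * c))
    (hρb.const_mul _) le_rfl hcρ fun x => mul_le_mul_of_nonneg_left (hcρ x) hk2.le)
  rw [hf.quadForm_eq (isBddCont_const _) (isBddCont_const _), integral_const_mul,
    integral_const_mul]
  obtain ⟨x, hx⟩ := Function.ne_iff.1 hf0
  have hx' : 0 < f x ^ 2 := by
    have : f x ≠ 0 := hx
    positivity
  have h2 := sq_le_integral_sq_add hf.hasDerivAt hf.memLp hf.memLp_deriv x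
  have h3 := integral_sq_nonneg f
  have h4 := integral_sq_nonneg (deriv f)
  rcases h3.eq_or_lt with h5 | h5
  · rw [← h5] at h2 ⊢
    have : 0 < c * ∫ x, deriv f x ^ 2 := mul_pos hc (by linarith)
    linarith
  · have : 0 < k ^ 2 * c * ∫ x, f x ^ 2 := by positivity
    have : 0 ≤ c * ∫ x, deriv f x ^ 2 := by positivity
    linarith

/-! ### Construction of the growing mode -/

/-- The growing mode of the general quadratic eigenvalue problem, given a function of positive
energy. -/
theorem exists_growing_mode {ρ : ℝ → ℝ} (hρ : IsRTProfile ρ) {μ g k a₀ a₁ a₂ : ℝ} (hμ : 0 < μ)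
    (hk : 0 < k) (ha₀ : 0 ≤ a₀) (ha₁ : 0 ≤ a₁) (ha₂ : 0 ≤ a₂) {f₀ : ℝ → ℝ}
    (hf₀ : IsClassicalH2 f₀)
    (hE : a₂ * (∫ x, deriv (deriv f₀) x ^ 2) + a₁ * (∫ x, deriv f₀ x ^ 2) +
      a₀ * (∫ x, f₀ x ^ 2) < g * k ^ 2 * ∫ x, deriv ρ x * f₀ x ^ 2) :
    ∃ lam : ℝ, 0 < lam ∧ ∃ ψ : ℝ → ℝ, ψ ≠ 0 ∧ ContDiff ℝ ∞ ψ ∧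
      (∀ n, MemLp (iteratedDeriv n ψ) 2) ∧
      ∀ x, (lam * μ + a₂) * iteratedDeriv 4 ψ x =
        deriv (fun y => (lam ^ 2 * ρ y + (2 * lam * μ * k ^ 2 + a₁)) * deriv ψ y) x -
        (lam ^ 2 * k ^ 2 * ρ x + (lam * μ * k ^ 4 + a₀) + -(g * k ^ 2) * deriv ρ x) * ψ x := by
  have hρs := hρ.isBddSmooth
  have hρb := hρs.isBddCont
  have hρ' : ContDiff ℝ ∞ (deriv ρ) := (contDiff_infty_iff_deriv.1 hρ.smooth).2
  have hρ's := isBddSmooth_of_hasCompactSupport hρ' hρ.compactSupport_deriv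
  have hρ'b := hρ's.isBddCont
  obtain ⟨C, hC⟩ := hρb.2
  obtain ⟨c, hc, hcρ⟩ := hρ.inf_pos
  have hC0 : 0 ≤ C := (abs_nonneg _).trans (hC 0)
  have hρC : ∀ x, ρ x ≤ C := fun x => (le_abs_self _).trans (hC x)
  set w : ℝ → ℝ := fun x => g * k ^ 2 * deriv ρ x with hwd
  have hwb : IsBddCont w := hρ'b.const_mul _
  have hws : HasCompactSupport w := hρ.compactSupport_deriv.mul_left
  obtain ⟨W, hW⟩ := hwb.2
  have hW0 : 0 ≤ W := (abs_nonneg _).trans (hW 0)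
  set V : Set (ℝ → ℝ) := {f | IsClassicalH2 f ∧ f ≠ 0}
  -- N is inertia, D is viscous dissipation without its factor μ, and E is buoyancy minus magnetic
  -- tension.
  set N : (ℝ → ℝ) → ℝ := quadForm 0 ρ (fun x => k ^ 2 * ρ x) with hNd
  set D : (ℝ → ℝ) → ℝ := quadForm 1 (fun _ => 2 * k ^ 2) (fun _ => k ^ 4) with hDd
  set E : (ℝ → ℝ) → ℝ := quadForm (-a₂) (fun _ => -a₁) (fun x => w x + -a₀) with hEd
  have bE : IsBddCont fun x => w x + -a₀ := hwb.add (isBddCont_const _)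
  have bN : IsBddCont fun x => k ^ 2 * ρ x := hρb.const_mul _
  set K : ℝ := 1 + C + k ^ 2 * C + 2 * k ^ 2 + k ^ 4 with hKd
  have hkC : 0 ≤ k ^ 2 * C := by positivity
  have hk2 : 0 < k ^ 2 := by positivity
  have hk4 : 0 < k ^ 4 := by positivity
  have hKT : ∀ f, K * sobolevSq f = quadForm K (fun _ => K) (fun _ => K) f := fun f => by
    rw [sobolevSq, const_mul_quadForm]
    simp only [mul_one]
  have hf₀E : 0 < E f₀ := by
    rw [hEd, hf₀.quadForm_eq (isBddCont_const _) bE, integral_const_mul]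
    have e : ∫ x, (w x + -a₀) * f₀ x ^ 2 =
        g * k ^ 2 * (∫ x, deriv ρ x * f₀ x ^ 2) + -a₀ * ∫ x, f₀ x ^ 2 := by
      rw [← integral_const_mul, ← integral_const_mul, ← integral_add
        ((hρ'b.integrable_mul hf₀.memLp.integrable_sq).const_mul _)
        (hf₀.memLp.integrable_sq.const_mul _)]
      exact integral_congr_ae (ae_of_all _ fun x => by simp only [hwd]; ring)
    rw [e]
    linarith
  have hf₀V : f₀ ∈ V := by
    refine ⟨hf₀, ?_⟩
    rintro rfl
    simp [hEd, quadForm] at hf₀E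
  -- K dominates every coefficient of N and D. The choice of L works because |w| ≤ W and ρ ≥ c give
  -- w ≤ L·k²ρ.
  obtain ⟨lam, hlam, hnn, hmin⟩ := exists_threshold (V := V) (N := N) (D := D) (E := E)
    (T := sobolevSq) (C := K) (L := W / (k ^ 2 * c)) hμ (by positivity)
    (fun f hf => hρ.quadForm_pos hk hf.1 hf.2)
    (fun f _ => integral_nonneg fun x => by simp only [Pi.zero_apply]; positivity)
    (fun f hf => (hf.1.sobolevSq_pos hf.2).le)
    (fun f hf => by
      rw [hKT]
      refine hf.1.quadForm_mono hρb (isBddCont_const _) bN (isBddCont_const _) (by positivity)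
        (fun x => by linarith [hρC x]) fun x => ?_
      linarith [mul_le_mul_of_nonneg_left (hρC x) hk2.le])
    (fun f hf => by
      rw [hKT]
      refine hf.1.quadForm_mono (isBddCont_const _) (isBddCont_const _) (isBddCont_const _)
        (isBddCont_const _) ?_ (fun x => ?_) fun x => ?_ <;> linarith)
    (fun f hf => by
      rw [hNd, const_mul_quadForm]
      have hL : 0 ≤ W / (k ^ 2 * c) := by positivity
      refine hf.1.quadForm_mono (isBddCont_const _) (hρb.const_mul _) bE (bN.const_mul _)
        (by simpa using ha₂) (fun x => ?_) fun x => ?_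
      · have := mul_nonneg hL (hc.le.trans (hcρ x))
        linarith
      · have h1 : W / (k ^ 2 * c) * (k ^ 2 * c) ≤ W / (k ^ 2 * c) * (k ^ 2 * ρ x) := by
          gcongr
          exact hcρ x
        rw [div_mul_cancel₀ _ (by positivity)] at h1
        linarith [(le_abs_self _).trans (hW x)])
    hf₀V hf₀E
  set b := lam * μ + a₂ with hbd
  set p : ℝ → ℝ := fun y => lam ^ 2 * ρ y + (2 * lam * μ * k ^ 2 + a₁) with hpd
  set q : ℝ → ℝ := fun x =>
    lam ^ 2 * k ^ 2 * ρ x + (lam * μ * k ^ 4 + a₀) + -(g * k ^ 2) * deriv ρ x with hqd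
  have hps : IsBddSmooth p := (hρs.const_mul _).add (isBddSmooth_const _)
  have hqs : IsBddSmooth q :=
    ((hρs.const_mul _).add (isBddSmooth_const _)).add (hρ's.const_mul _)
  have hb : 0 < b := by positivity
  have hform : ∀ f, IsClassicalH2 f →
      lam ^ 2 * N f + lam * μ * D f - E f = quadForm b p q f := fun f hf => by
    have e : -E f = -1 * E f := by ring
    rw [sub_eq_add_neg, e, hNd, hDd, hEd, const_mul_quadForm, const_mul_quadForm,
      const_mul_quadForm, hf.quadForm_add (hρb.const_mul _) (isBddCont_const _)
        (bN.const_mul _) (isBddCont_const _),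
      hf.quadForm_add ((hρb.const_mul _).add (isBddCont_const _)) (isBddCont_const _)
        ((bN.const_mul _).add (isBddCont_const _)) (bE.const_mul _)]
    congr 1
    · rw [hbd]; ring
    · funext x
      simp only [hpd]; ring
    · funext x
      simp only [hqd, hwd]; ring
  -- Adding w back cancels the only term of possibly negative sign, and viscosity alone then
  -- controls the H² norm.
  set c₀ := lam * μ * min 1 (min (2 * k ^ 2) (k ^ 4)) with hc₀d
  have hlμ : 0 < lam * μ := mul_pos hlam hμ
  have hc₀ : 0 < c₀ := mul_pos hlμ (lt_min one_pos (lt_min (by positivity) hk4))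
  have hm1 : c₀ ≤ lam * μ * 1 := mul_le_mul_of_nonneg_left (min_le_left _ _) hlμ.le
  have hm2 : c₀ ≤ lam * μ * (2 * k ^ 2) :=
    mul_le_mul_of_nonneg_left ((min_le_right _ _).trans (min_le_left _ _)) hlμ.le
  have hm3 : c₀ ≤ lam * μ * k ^ 4 :=
    mul_le_mul_of_nonneg_left ((min_le_right _ _).trans (min_le_right _ _)) hlμ.le
  have hcoer : ∀ f, IsClassicalH2 f →
      c₀ * sobolevSq f ≤ quadForm b p q f + ∫ x, w x * f x ^ 2 := fun f hf => by
    have hw' : quadForm 0 (fun _ => 0) w f = ∫ x, w x * f x ^ 2 := by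
      simp [quadForm]
    rw [← hw', hf.quadForm_add hps.isBddCont (isBddCont_const _) hqs.isBddCont hwb, sobolevSq,
      const_mul_quadForm]
    refine hf.quadForm_mono (isBddCont_const _) (hps.isBddCont.add (isBddCont_const _))
      (isBddCont_const _) (hqs.isBddCont.add hwb) (by linarith) (fun x => ?_) fun x => ?_
    · have : 0 ≤ lam ^ 2 * ρ x := mul_nonneg (sq_nonneg _) (hc.le.trans (hcρ x))
      simp only [hpd]
      linarith
    · have : 0 ≤ lam ^ 2 * k ^ 2 * ρ x := mul_nonneg (by positivity) (hc.le.trans (hcρ x))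
      simp only [hqd, hwd]
      linarith
  obtain ⟨ψ, ψ', hd, hψ'c, hψ2, hψ'2, hdiff, hpos, hweak⟩ := exists_weak_solution (b := b)
    (p := p) (q := q) (w := w) hc₀ hps.isBddCont hqs.isBddCont hwb.1 hws hcoer
    (fun f hf => by
      by_cases h0 : f = 0
      · simp [h0, quadForm]
      · rw [← hform f hf]
        exact hnn f ⟨hf, h0⟩)
    (fun ε hε => by
      obtain ⟨f, ⟨hf, hf0⟩, hle⟩ := hmin ε hε
      exact ⟨f, hf, hf0, by rwa [← hform f hf]⟩)
  obtain ⟨hψ, hode⟩ := contDiff_of_weak_solution hb.ne' hps.1 hqs.1 hd hψ'c hweak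
  refine ⟨lam, hlam, ψ, ?_, hψ, ?_, hode⟩
  · rintro rfl
    simp at hpos
  · refine memLp_two_iteratedDeriv_of_solution hb.ne' hps.1 hqs.1 hps.2 hqs.2 hψ hode ?_
    have hdψ : deriv ψ = ψ' := funext fun x => (hd x).deriv
    have h1 : iteratedDeriv 1 ψ = ψ' := by rw [iteratedDeriv_one, hdψ]
    have h2 : MemLp (iteratedDeriv 2 ψ) 2 := by
      refine memLp_two_second_deriv (fun x => ?_) hdiff
      rw [← h1]
      exact hasDerivAt_iteratedDeriv hψ 1 x
    intro j hj
    interval_cases j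
    · simpa using hψ2
    · rwa [h1]
    · exact h2

/-- A growing mode, normalized in the weighted energy. -/
theorem exists_normalized_growing_mode {ρ : ℝ → ℝ} (hρ : IsRTProfile ρ) {μ g a₀ a₁ a₂ : ℝ}
    {ξ : EuclideanSpace ℝ (Fin 2)} (hμ : 0 < μ) (hk : 0 < ‖ξ‖) (ha₀ : 0 ≤ a₀) (ha₁ : 0 ≤ a₁)
    (ha₂ : 0 ≤ a₂) {f₀ : ℝ → ℝ} (hf₀ : IsClassicalH2 f₀)
    (hE : a₂ * (∫ x, deriv (deriv f₀) x ^ 2) + a₁ * (∫ x, deriv f₀ x ^ 2) +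
      a₀ * (∫ x, f₀ x ^ 2) < g * ‖ξ‖ ^ 2 * ∫ x, deriv ρ x * f₀ x ^ 2) :
    ∃ (ψ : ℝ → ℝ) (lam : ℝ), 0 < lam ∧ ψ ≠ 0 ∧ ContDiff ℝ ∞ ψ ∧
      (∀ x, -lam ^ 2 * (ρ x * ‖ξ‖ ^ 2 * ψ x - deriv (fun y => ρ y * deriv ψ y) x) =
        lam * μ * (‖ξ‖ ^ 4 * ψ x - 2 * ‖ξ‖ ^ 2 * iteratedDeriv 2 ψ x + iteratedDeriv 4 ψ x)
          - g * ‖ξ‖ ^ 2 * deriv ρ x * ψ x +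
          (a₀ * ψ x - a₁ * iteratedDeriv 2 ψ x + a₂ * iteratedDeriv 4 ψ x)) ∧
      VanishesAtInfinity ψ ∧ MemHInfty ψ ∧ ψ ∈ admissibleSet ρ ξ := by
  set k := ‖ξ‖ with hkd
  obtain ⟨lam, hlam, u, hu0, hu, huL, hode⟩ :=
    exists_growing_mode hρ hμ hk ha₀ ha₁ ha₂ hf₀ hE
  have huH : IsClassicalH2 u := by
    refine ⟨hu.of_le (WithTop.coe_le_coe.2 le_top), by simpa using huL 0,
      by simpa using huL 1, ?_⟩
    have := huL 2
    rwa [iteratedDeriv_succ, iteratedDeriv_one] at this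
  have hNpos := hρ.quadForm_pos hk huH hu0
  set N := quadForm 0 ρ (fun x => k ^ 2 * ρ x) u with hN
  set s := (√N)⁻¹ with hs
  have hs0 : 0 < s := inv_pos.2 (Real.sqrt_pos.2 hNpos)
  have hs2 : s ^ 2 * N = 1 := by
    rw [hs, inv_pow, Real.sq_sqrt hNpos.le, inv_mul_cancel₀ hNpos.ne']
  set ψ : ℝ → ℝ := fun x => s * u x with hψd
  have hψ : ContDiff ℝ ∞ ψ := contDiff_const.mul hu
  have hψi : ∀ n x, iteratedDeriv n ψ x = s * iteratedDeriv n u x := fun n x =>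
    iteratedDeriv_const_mul_field s u
  have hψL : ∀ n, MemLp (iteratedDeriv n ψ) 2 := fun n => by
    rw [show iteratedDeriv n ψ = fun x => s * iteratedDeriv n u x from funext (hψi n)]
    exact (huL n).const_mul s
  have hdψ : deriv ψ = fun x => s * deriv u x := by
    funext x
    simpa using hψi 1 x
  have hder : ∀ x, HasDerivAt ψ (deriv ψ x) x := fun x =>
    (hψ.differentiable (by simp) x).hasDerivAt
  have hψ' : ContDiff ℝ ∞ (deriv ψ) := (contDiff_infty_iff_deriv.1 hψ).2
  have hder' : ∀ x, HasDerivAt (deriv ψ) (iteratedDeriv 2 ψ x) x := fun x => by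
    have := hasDerivAt_iteratedDeriv hψ 1 x
    rwa [iteratedDeriv_one] at this
  have hL0 : MemLp ψ 2 := by simpa using hψL 0
  have hL1 : MemLp (deriv ψ) 2 := by simpa using hψL 1
  have hInf : MemHInfty ψ := memHInfty_of_memLp_iteratedDeriv hψ hψL
  refine ⟨ψ, lam, hlam, ?_, hψ, fun x => ?_,
    ⟨tendsto_atBot_zero_of_memLp_two hder hL0 hL1,
      tendsto_atBot_zero_of_memLp_two hder' hL1 (hψL 2),
      tendsto_atTop_zero_of_memLp_two hder hL0 hL1,
      tendsto_atTop_zero_of_memLp_two hder' hL1 (hψL 2)⟩, hInf, hInf 2, deriv ψ,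
    hasWeakDeriv_of_hasDerivAt hder hψ'.continuous, ?_⟩
  · obtain ⟨x, hx⟩ := Function.ne_iff.1 hu0
    exact Function.ne_iff.2 ⟨x, mul_ne_zero hs0.ne' hx⟩
  · have hdu' : ∀ x, HasDerivAt (deriv u) (iteratedDeriv 2 u x) x := fun x => by
      have := hasDerivAt_iteratedDeriv hu 1 x
      rwa [iteratedDeriv_one] at this
    have hdρ : HasDerivAt ρ (deriv ρ x) x := (hρ.smooth.differentiable (by simp) x).hasDerivAt
    have e1 : deriv (fun y => ρ y * deriv ψ y) x =
        s * (deriv ρ x * deriv u x + ρ x * iteratedDeriv 2 u x) := by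
      rw [hdψ]
      have := (hdρ.fun_mul ((hdu' x).const_mul s)).deriv
      rw [this]
      ring
    have e2 : deriv (fun y => (lam ^ 2 * ρ y + (2 * lam * μ * k ^ 2 + a₁)) * deriv u y) x =
        lam ^ 2 * deriv ρ x * deriv u x +
          (lam ^ 2 * ρ x + (2 * lam * μ * k ^ 2 + a₁)) * iteratedDeriv 2 u x :=
      (((hdρ.const_mul (lam ^ 2)).add_const (2 * lam * μ * k ^ 2 + a₁)).fun_mul (hdu' x)).deriv
    have h := hode x
    rw [e2] at h
    rw [e1, hψi, hψi]
    simp only [hψd]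
    linear_combination -s * h
  · have hsc : quadForm 0 ρ (fun x => k ^ 2 * ρ x) (fun x => s * u x + 0 * u x) = 1 := by
      rw [huH.quadForm_lin huH hρ.isBddSmooth.isBddCont (hρ.isBddSmooth.isBddCont.const_mul _),
        ← hN]
      linarith
    rw [← hsc, quadForm]
    simp only [zero_mul, add_zero, zero_add]
    exact integral_congr_ae (ae_of_all _ fun x => by simp only [hψd]; ring)

/-! ### Functions of positive energy -/

theorem exists_pos_energy {ρ : ℝ → ℝ} (hρ : IsRTProfile ρ) :
    ∃ f, IsClassicalH2 f ∧ 0 < ∫ x, deriv ρ x * f x ^ 2 := by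
  obtain ⟨x₀, hx₀⟩ := hρ.exists_deriv_pos
  have hc : Continuous (deriv ρ) := hρ.smooth.continuous_deriv (by simp)
  obtain ⟨r, hr, hball⟩ := Metric.isOpen_iff.1 (isOpen_lt continuous_const hc) x₀ hx₀
  let φ : ContDiffBump x₀ := ⟨r / 2, r, by positivity, by linarith⟩
  have hφ : IsClassicalH2 φ := .of_hasCompactSupport φ.contDiff φ.hasCompactSupport
  refine ⟨φ, hφ, (hc.mul (hφ.continuous.pow 2)).integral_pos_of_hasCompactSupport_nonneg_nonzero
    (HasCompactSupport.mul_left ?_) (fun x => ?_) (x := x₀) ?_⟩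
  · exact φ.hasCompactSupport.comp_left (g := fun y : ℝ => y ^ 2) (by simp)
  · by_cases hx : x ∈ Metric.ball x₀ r
    · exact mul_nonneg (le_of_lt (hball hx)) (sq_nonneg _)
    · have : φ x = 0 := φ.zero_of_le_dist (not_lt.1 hx)
      simp [this]
  · have h1 : φ x₀ = 1 := φ.one_of_mem_closedBall (Metric.mem_closedBall_self φ.rIn_pos.le)
    simp [h1, hx₀.ne']

/-- Mollification does not increase the stabilizing norms, while the buoyancy integral converges
because ρ' is continuous with compact support. This transfers the strict inequalities behind the
critical numbers to C² functions. -/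
theorem exists_classical_of_lt {ρ ψ ψ' : ℝ → ℝ} (hρ : IsRTProfile ρ) (hψ : MemLp ψ 2)
    (hψ' : MemLp ψ' 2) (hw : HasWeakDeriv ψ ψ') {c : ℝ} (hc : c < ∫ x, deriv ρ x * ψ x ^ 2) :
    ∃ f, IsClassicalH2 f ∧ (∫ x, f x ^ 2 ≤ ∫ x, ψ x ^ 2) ∧
      (∫ x, deriv f x ^ 2 ≤ ∫ x, ψ' x ^ 2) ∧
      (∀ ψ'', MemLp ψ'' 2 → HasWeakDeriv ψ' ψ'' →
        ∫ x, deriv (deriv f) x ^ 2 ≤ ∫ x, ψ'' x ^ 2) ∧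
      c < ∫ x, deriv ρ x * f x ^ 2 := by
  obtain ⟨F, hF, h0, h1, h2, hlim⟩ := exists_mollification hψ hψ' hw
  obtain ⟨n, hn⟩ := ((hlim _ (hρ.smooth.continuous_deriv (by simp))
    hρ.compactSupport_deriv).eventually_const_lt hc).exists
  exact ⟨F n, hF n, h0 n, h1 n, fun ψ'' ha hb => h2 ψ'' ha hb n, hn⟩

theorem exists_energy_of_lt_criticalFrequency {g M : ℝ} (hg : 0 < g) {ρ : ℝ → ℝ}
    (hρ : IsRTProfile ρ) {ξ : EuclideanSpace ℝ (Fin 2)} (hξ : M * ξ 0 ≠ 0) (hk : 0 < ‖ξ‖)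
    (h : ‖ξ‖ < criticalFrequency g M ρ ξ) :
    ∃ f, IsClassicalH2 f ∧ (M * ξ 0) ^ 2 * (∫ x, deriv f x ^ 2) +
      (M * ξ 0) ^ 2 * ‖ξ‖ ^ 2 * (∫ x, f x ^ 2) < g * ‖ξ‖ ^ 2 * ∫ x, deriv ρ x * f x ^ 2 := by
  rw [criticalFrequency, Real.lt_sqrt hk.le] at h
  -- An empty set of quotients would have supremum 0 by convention, which does not exceed |ξ|².
  obtain ⟨r, ⟨ψ, ψ', hψ, hw, -, rfl⟩, hr⟩ := exists_lt_of_lt_csSup (by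
    by_contra hne
    rw [Set.not_nonempty_iff_eq_empty.1 hne, Real.sSup_empty] at h
    exact absurd h (not_lt.2 (sq_nonneg _))) h
  have hψ' := hψ.memLp_two_weakDeriv hw
  have hm : 0 < (M * ξ 0) ^ 2 := by positivity
  have hk2 : 0 < ‖ξ‖ ^ 2 := by positivity
  have hC : 0 < ∫ x, ψ x ^ 2 := by
    refine (integral_sq_nonneg ψ).lt_of_ne fun h0 => ?_
    rw [← h0, div_zero] at hr
    linarith
  rw [lt_div_iff₀ hC, lt_sub_iff_add_lt, lt_div_iff₀ hm] at hr
  set c := (‖ξ‖ ^ 2 * (∫ x, ψ x ^ 2) + ∫ x, ψ' x ^ 2) * (M * ξ 0) ^ 2 with hcd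
  have hgk : 0 < g * ‖ξ‖ ^ 2 := by positivity
  obtain ⟨f, hf, h0, h1, -, hlt⟩ := exists_classical_of_lt hρ hψ.memLp_two hψ' hw
    (c := c / (g * ‖ξ‖ ^ 2)) (by rwa [div_lt_iff₀ hgk, mul_comm])
  refine ⟨f, hf, ?_⟩
  rw [div_lt_iff₀ hgk, mul_comm] at hlt
  refine lt_of_le_of_lt ?_ hlt
  have e1 := mul_le_mul_of_nonneg_left h1 hm.le
  have e0 := mul_le_mul_of_nonneg_left h0 (mul_pos hm hk2).le
  rw [hcd]
  linarith

theorem exists_quotient_of_lt_criticalNumber {g M : ℝ} (hg : 0 < g) (hM : M ≠ 0) {ρ : ℝ → ℝ}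
    (hρ : IsRTProfile ρ) (h : ENNReal.ofReal |M| < criticalNumber g ρ) :
    ∃ f, IsClassicalH2 f ∧
      M ^ 2 * (∫ x, deriv f x ^ 2) < g * ∫ x, deriv ρ x * f x ^ 2 := by
  have hM2 : 0 < M ^ 2 := by positivity
  have h1 : ((M ^ 2 : ℝ) : EReal) < sSup (criticalQuotients g ρ) := by
    by_contra! hle
    have h2 := EReal.toENNReal_le_toENNReal hle
    have h3 : criticalNumber g ρ ≤ ENNReal.ofReal |M| := by
      refine (ENNReal.rpow_le_rpow h2 (by norm_num)).trans (le_of_eq ?_)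
      rw [EReal.toENNReal_of_ne_top (EReal.coe_ne_top _), EReal.toReal_coe,
        ENNReal.ofReal_rpow_of_nonneg hM2.le (by norm_num), ← Real.sqrt_eq_rpow,
        Real.sqrt_sq_eq_abs]
    exact absurd h (not_lt.2 h3)
  obtain ⟨_, ⟨ψ, ψ', hψ, hw, -, rfl⟩, hr⟩ := lt_sSup_iff.1 h1
  rw [EReal.coe_lt_coe_iff] at hr
  -- A vanishing denominator would make the quotient 0 by convention, contradicting that it exceeds
  -- M² > 0.
  have hB : 0 < ∫ x, ψ' x ^ 2 := by
    refine (integral_sq_nonneg ψ').lt_of_ne fun h0 => ?_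
    rw [← h0, div_zero] at hr
    linarith
  simp only [mul_assoc] at hr
  rw [lt_div_iff₀ hB, integral_const_mul] at hr
  obtain ⟨f, hf, -, h1, -, hlt⟩ := exists_classical_of_lt hρ hψ.memLp_two
    (hψ.memLp_two_weakDeriv hw) hw (c := M ^ 2 * (∫ x, ψ' x ^ 2) / g)
    (by rwa [div_lt_iff₀ hg, mul_comm _ g])
  refine ⟨f, hf, ?_⟩
  rw [div_lt_iff₀ hg, mul_comm _ g] at hlt
  exact (mul_le_mul_of_nonneg_left h1 hM2.le).trans_lt hlt

theorem exists_energy_of_verticalCriticalFrequency_lt {g M k : ℝ} (hg : 0 < g) (hM : M ≠ 0)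
    {ρ : ℝ → ℝ} (hρ : IsRTProfile ρ) (hMc : ENNReal.ofReal |M| < criticalNumber g ρ)
    (hk : 0 < k) (h : verticalCriticalFrequency g M ρ < k) :
    ∃ f, IsClassicalH2 f ∧ M ^ 2 * (∫ x, deriv (deriv f) x ^ 2) +
      M ^ 2 * k ^ 2 * (∫ x, deriv f x ^ 2) < g * k ^ 2 * ∫ x, deriv ρ x * f x ^ 2 := by
  have hM2 : 0 < M ^ 2 := by positivity
  have hk2 : 0 < k ^ 2 := by positivity
  have hρ'b : IsBddCont (deriv ρ) := .of_hasCompactSupport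
    (hρ.smooth.continuous_deriv (by simp)) hρ.compactSupport_deriv
  have split : ∀ u u' : ℝ → ℝ, MemLp u 2 → MemLp u' 2 →
      ∫ x, (g * deriv ρ x * u x ^ 2 - M ^ 2 * u' x ^ 2) =
        g * (∫ x, deriv ρ x * u x ^ 2) - M ^ 2 * ∫ x, u' x ^ 2 := fun u u' hu hu' => by
    rw [← integral_const_mul, ← integral_const_mul, ← integral_sub
      ((hρ'b.integrable_mul hu.integrable_sq).const_mul g) (hu'.integrable_sq.const_mul _)]
    exact integral_congr_ae (ae_of_all _ fun x => by simp only; ring)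
  rw [verticalCriticalFrequency, Real.sqrt_lt' hk] at h
  -- The infimum is informative only over a nonempty set; |M| < M_c supplies an element.
  obtain ⟨r, ⟨ψ, ψ', ψ'', hψ, hw, hw', hpos, rfl⟩, hr⟩ := exists_lt_of_csInf_lt (by
    obtain ⟨f, hf, hlt⟩ := exists_quotient_of_lt_criticalNumber hg hM hρ hMc
    refine ⟨_, f, deriv f, deriv (deriv f), hf.memH_two,
      hasWeakDeriv_of_hasDerivAt hf.hasDerivAt hf.continuous_deriv,
      hasWeakDeriv_of_hasDerivAt hf.hasDerivAt_deriv hf.continuous_deriv_deriv, ?_, rfl⟩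
    rw [split _ _ hf.memLp hf.memLp_deriv]
    linarith) h
  have hψ' := hψ.memLp_two_weakDeriv hw
  have hψ'' := hψ.memLp_two_weakDeriv_weakDeriv hw hw'
  rw [div_lt_iff₀ hpos, split _ _ hψ.memLp_two hψ'] at hr
  set c := M ^ 2 * (∫ x, ψ'' x ^ 2) + M ^ 2 * k ^ 2 * ∫ x, ψ' x ^ 2 with hcd
  have hgk : 0 < g * k ^ 2 := by positivity
  obtain ⟨f, hf, -, h1, h2, hlt⟩ := exists_classical_of_lt hρ hψ.memLp_two hψ' hw
    (c := c / (g * k ^ 2)) (by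
      rw [div_lt_iff₀ hgk, hcd]
      linarith)
  refine ⟨f, hf, ?_⟩
  rw [div_lt_iff₀ hgk, mul_comm] at hlt
  refine lt_of_le_of_lt ?_ hlt
  have e1 := mul_le_mul_of_nonneg_left h1 (mul_pos hM2 hk2).le
  have e2 := mul_le_mul_of_nonneg_left (h2 ψ'' hψ'' hw') hM2.le
  linarith

/-! ### The two field directions -/

theorem theorem2p1 (μ g M : ℝ) (hμ : 0 < μ) (hg : 0 < g) (ρ : ℝ → ℝ) (hρ : IsRTProfile ρ)
    (d : FieldDirection) (hM : M ≠ 0)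
    (hMc : d = FieldDirection.vertical → ENNReal.ofReal |M| < criticalNumber g ρ)
    (ξ : EuclideanSpace ℝ (Fin 2)) (hξ : ξ ∈ solvableDomain g M ρ d) :
    ∃ (ψ : ℝ → ℝ) (lam : ℝ), 0 < lam ∧ ψ ≠ 0 ∧ ContDiff ℝ ∞ ψ ∧
      SatisfiesODE d μ g M ρ ξ lam ψ ∧ VanishesAtInfinity ψ ∧
      MemHInfty ψ ∧ ψ ∈ admissibleSet ρ ξ := by
  cases d with
  | horizontal =>
    obtain ⟨hξ, hξ0⟩ := hξ
    have hk : 0 < ‖ξ‖ := norm_pos_iff.2 hξ0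
    have hm : 0 ≤ M ^ 2 * ξ 0 ^ 2 := by positivity
    have hf : ∃ f, IsClassicalH2 f ∧ 0 * (∫ x, deriv (deriv f) x ^ 2) +
        M ^ 2 * ξ 0 ^ 2 * (∫ x, deriv f x ^ 2) +
        M ^ 2 * ξ 0 ^ 2 * ‖ξ‖ ^ 2 * (∫ x, f x ^ 2) <
          g * ‖ξ‖ ^ 2 * ∫ x, deriv ρ x * f x ^ 2 := by
      by_cases h0 : ξ 0 = 0
      -- The magnetic term vanishes when ξ₁ = 0, so a bump where ρ' > 0 already has positive energy.
      · obtain ⟨f, hf, hpos⟩ := exists_pos_energy hρ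
        refine ⟨f, hf, ?_⟩
        rw [h0]
        have : 0 < g * ‖ξ‖ ^ 2 * ∫ x, deriv ρ x * f x ^ 2 := by positivity
        simpa using this
      · obtain ⟨-, -, hlt⟩ := hξ.resolve_right h0
        obtain ⟨f, hf, hE⟩ := exists_energy_of_lt_criticalFrequency hg hρ
          (mul_ne_zero hM h0) hk hlt
        refine ⟨f, hf, ?_⟩
        rw [mul_pow] at hE
        linarith
    obtain ⟨f, hf, hE⟩ := hf
    -- Horizontal field: a₀ = M²ξ₁²|ξ|², a₁ = M²ξ₁², a₂ = 0.
    obtain ⟨ψ, lam, h1, h2, h3, hode, h4⟩ := exists_normalized_growing_mode hρ hμ hk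
      (mul_nonneg hm (sq_nonneg ‖ξ‖)) hm le_rfl hf hE
    refine ⟨ψ, lam, h1, h2, h3, fun x => ?_, h4⟩
    rw [hode x, magneticTerm]
    ring
  | vertical =>
    have hlt : verticalCriticalFrequency g M ρ < ‖ξ‖ := hξ
    have hk : 0 < ‖ξ‖ := (Real.sqrt_nonneg _).trans_lt hlt
    obtain ⟨f, hf, hE⟩ :=
      exists_energy_of_verticalCriticalFrequency_lt hg hM hρ (hMc rfl) hk hlt
    obtain ⟨ψ, lam, h1, h2, h3, hode, h4⟩ := exists_normalized_growing_mode (g := g) (a₀ := 0)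
      (a₁ := M ^ 2 * ‖ξ‖ ^ 2) (a₂ := M ^ 2) hρ hμ hk le_rfl (by positivity) (by positivity) hf
      (by linarith)
    refine ⟨ψ, lam, h1, h2, h3, fun x => ?_, h4⟩
    rw [hode x, magneticTerm]
    ring
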